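/- Let $H$ be a finite-dimensional complex Hilbert space, $t$ the transposition on $B(H)$ with respect to an orthonormal basis $(e_i)$ of $H$, and identify $B(H)\otimes B(H)$ with $B(H\otimes H)$. Put $$C_p=\Big\{\sum_{i=1}^n x_i\otimes y_i : n\in\mathbb N,\ x_i,y_i\in B(H)_+\Big\},\quad C_{cp}=(B(H)\otimes B(H))_+,\quad C_d=C_{cp}\cap (\mathrm{id}\otimes t)(C_{cp}).$$ A linear map $T:B(H)\to B(H)$ is positive if $T(B(H)_+)\subseteq B(H)_+$, completely positive if $\mathrm{id}_{M_k}\otimes T$ is positive for all $k$, and decomposable if $T=T_1+T_2$ with $T_1$ and $t\circ T_2$ completely positive. For every such $H$ and every orthonormal basis of $H$ the following hold. 1. If $\dim H=2$, then $C_d=C_p$. Moreover, if $h\in H\otimes H$ and $(\mathrm{id}\otimes t)(|h\rangle\langle h|)$ is positive, then $h=f\otimes g$ for some $f,g\in H$, and hence $|h\rangle\langle h|=|f\rangle\langle f|\otimes|g\rangle\langle g|$. 2. If $\dim H=3$, then $C_p\subsetneq C_d$. Explicitly, the operator whose matrix in the basis $e_i\otimes e_j$ (ordered lexicographically) is Choi's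 matrix $$\begin{pmatrix}1&0&0&0&1&0&0&0&1\\0&2&0&1&0&0&0&0&0\\0&0&\tfrac12&0&0&0&1&0&0\\0&1&0&\tfrac12&0&0&0&0&0\\1&0&0&0&1&0&0&0&1\\0&0&0&0&0&2&0&1&0\\0&0&1&0&0&0&2&0&0\\0&0&0&0&0&1&0&\tfrac12&0\\1&0&0&0&1&0&0&0&1\end{pmatrix}$$ lies in $C_d$ but not in $C_p$. 3. In any finite dimension, $C_d\ne C_p$ if and only if there is a positive linear map $T:B(H)\to B(H)$ that is not decomposable. -/

import Mathlib

open scoped TensorProduct CStarAlgebra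

noncomputable section

namespace TensorCones

/-- The canonical identification `B(H) ⊗ B(H) ≃ B(H ⊗ H)` for a finite-dimensional `H`:
`a ⊗ b` is sent to the operator with `f ⊗ g ↦ (a f) ⊗ (b g)`. -/
def toOperator (H : Type*) [NormedAddCommGroup H] [InnerProductSpace ℂ H]
    [FiniteDimensional ℂ H] :
    ((H →L[ℂ] H) ⊗[ℂ] (H →L[ℂ] H)) ≃ₗ[ℂ] ((H ⊗[ℂ] H) →L[ℂ] (H ⊗[ℂ] H)) :=
  TensorProduct.congr LinearMap.toContinuousLinearMap.symm LinearMap.toContinuousLinearMap.symm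
    ≪≫ₗ homTensorHomEquiv ℂ H H H H ≪≫ₗ LinearMap.toContinuousLinearMap

/-- The transpose map `t` of `B(H)` with respect to the orthonormal basis `b`. -/
def transposeMap {H : Type*} [NormedAddCommGroup H] [InnerProductSpace ℂ H]
    [FiniteDimensional ℂ H] {n : ℕ} (b : OrthonormalBasis (Fin n) ℂ H) :
    (H →L[ℂ] H) →ₗ[ℂ] (H →L[ℂ] H) :=
  (LinearMap.toContinuousLinearMap.symm ≪≫ₗ LinearMap.toMatrix b.toBasis b.toBasis
    ≪≫ₗ Matrix.transposeLinearEquiv (Fin n) (Fin n) ℂ ℂ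
    ≪≫ₗ Matrix.toLin b.toBasis b.toBasis
    ≪≫ₗ LinearMap.toContinuousLinearMap).toLinearMap

/-- The partial transpose `id ⊗ t` on `B(H) ⊗ B(H)`. -/
def partialTranspose {H : Type*} [NormedAddCommGroup H] [InnerProductSpace ℂ H]
    [FiniteDimensional ℂ H] {n : ℕ} (b : OrthonormalBasis (Fin n) ℂ H) :
    ((H →L[ℂ] H) ⊗[ℂ] (H →L[ℂ] H)) →ₗ[ℂ] ((H →L[ℂ] H) ⊗[ℂ] (H →L[ℂ] H)) :=
  (transposeMap b).lTensor (H →L[ℂ] H)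

/-- The projective cone `C_p`: finite sums of `x ⊗ y` with `x, y` positive. -/
def projectiveCone (H : Type*) [NormedAddCommGroup H] [InnerProductSpace ℂ H] :
    Set ((H →L[ℂ] H) ⊗[ℂ] (H →L[ℂ] H)) :=
  {u | ∃ (n : ℕ) (x y : Fin n → (H →L[ℂ] H)),
    (∀ i, 0 ≤ x i) ∧ (∀ i, 0 ≤ y i) ∧ u = ∑ i, x i ⊗ₜ[ℂ] y i}

/-- The cone `C_cp = (B(H) ⊗ B(H))₊` of elements that are positive operators on `H ⊗ H`. -/
def positiveCone (H : Type*) [NormedAddCommGroup H] [InnerProductSpace ℂ H]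
    [FiniteDimensional ℂ H] : Set ((H →L[ℂ] H) ⊗[ℂ] (H →L[ℂ] H)) :=
  {u | 0 ≤ toOperator H u}

/-- The cone `C_d = C_cp ∩ (id ⊗ t)(C_cp)`. -/
def decomposableCone {H : Type*} [NormedAddCommGroup H] [InnerProductSpace ℂ H]
    [FiniteDimensional ℂ H] {n : ℕ} (b : OrthonormalBasis (Fin n) ℂ H) :
    Set ((H →L[ℂ] H) ⊗[ℂ] (H →L[ℂ] H)) :=
  positiveCone H ∩ partialTranspose b '' positiveCone H

/-- The operator `|h⟩⟨h|`, as an element of `B(H) ⊗ B(H)`. -/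
def ketBra {H : Type*} [NormedAddCommGroup H] [InnerProductSpace ℂ H]
    [FiniteDimensional ℂ H] (h : H ⊗[ℂ] H) : (H →L[ℂ] H) ⊗[ℂ] (H →L[ℂ] H) :=
  (toOperator H).symm (InnerProductSpace.rankOne ℂ h h)

/-- Choi's matrix in `M₃(ℂ) ⊗ M₃(ℂ) = M₉(ℂ)`; rows and columns are ordered lexicographically. -/
def choiMatrix : Matrix (Fin 3 × Fin 3) (Fin 3 × Fin 3) ℂ :=
  Matrix.submatrix
    !![1, 0, 0,   0,   1, 0, 0, 0,   1;
       0, 2, 0,   1,   0, 0, 0, 0,   0;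
       0, 0, 1/2, 0,   0, 0, 1, 0,   0;
       0, 1, 0,   1/2, 0, 0, 0, 0,   0;
       1, 0, 0,   0,   1, 0, 0, 0,   1;
       0, 0, 0,   0,   0, 2, 0, 1,   0;
       0, 0, 1,   0,   0, 0, 2, 0,   0;
       0, 0, 0,   0,   0, 1, 0, 1/2, 0;
       1, 0, 0,   0,   1, 0, 0, 0,   1]
    finProdFinEquiv finProdFinEquiv

/-- The element of `B(H) ⊗ B(H)` whose matrix in the basis `b i ⊗ b j` is Choi's matrix. -/
def choiElement {H : Type*} [NormedAddCommGroup H] [InnerProductSpace ℂ H]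
    (b : OrthonormalBasis (Fin 3) ℂ H) : (H →L[ℂ] H) ⊗[ℂ] (H →L[ℂ] H) :=
  ∑ p : Fin 3 × Fin 3, ∑ q : Fin 3 × Fin 3, choiMatrix p q •
    (InnerProductSpace.rankOne ℂ (b p.1) (b q.1) ⊗ₜ[ℂ]
      InnerProductSpace.rankOne ℂ (b p.2) (b q.2))

/-- A linear map of `B(H)` is positive if it preserves positive operators. -/
def IsPositiveMap {H : Type*} [NormedAddCommGroup H] [InnerProductSpace ℂ H]
    (T : (H →L[ℂ] H) →ₗ[ℂ] (H →L[ℂ] H)) : Prop :=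
  ∀ a, 0 ≤ a → 0 ≤ T a

/-- `T` is completely positive (in Mathlib's sense: all `id_{M_k} ⊗ T` are positive). -/
def IsCompletelyPositive {H : Type*} [NormedAddCommGroup H] [InnerProductSpace ℂ H]
    [FiniteDimensional ℂ H] (T : (H →L[ℂ] H) →ₗ[ℂ] (H →L[ℂ] H)) : Prop :=
  haveI : CompleteSpace H := FiniteDimensional.complete ℂ H
  ∃ φ : (H →L[ℂ] H) →CP (H →L[ℂ] H), φ.toLinearMap = T

/-- `T` is co-positive if `t ∘ T` is completely positive. -/
def IsCopositive {H : Type*} [NormedAddCommGroup H] [InnerProductSpace ℂ H]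
    [FiniteDimensional ℂ H] {n : ℕ} (b : OrthonormalBasis (Fin n) ℂ H)
    (T : (H →L[ℂ] H) →ₗ[ℂ] (H →L[ℂ] H)) : Prop :=
  IsCompletelyPositive (transposeMap b ∘ₗ T)

/-- `T` is decomposable if it is the sum of a completely positive and a co-positive map. -/
def IsDecomposable {H : Type*} [NormedAddCommGroup H] [InnerProductSpace ℂ H]
    [FiniteDimensional ℂ H] {n : ℕ} (b : OrthonormalBasis (Fin n) ℂ H)
    (T : (H →L[ℂ] H) →ₗ[ℂ] (H →L[ℂ] H)) : Prop :=
  ∃ T₁ T₂ : (H →L[ℂ] H) →ₗ[ℂ] (H →L[ℂ] H),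
    IsCompletelyPositive T₁ ∧ IsCopositive b T₂ ∧ T = T₁ + T₂

end TensorCones

end

/-! In an orthonormal basis the cones become sets of matrices: `separableCone` for C_p and `pptCone`
for C_d. The inclusion C_p ⊆ C_d is clear, since the transpose of a positive matrix is positive. The
three claims rest on different ideas.

Dimension 2. By closedness (`isClosed_separableCone`) X may be taken positive definite. A local
filter A ⊗ B that minimizes the trace for given determinants (`exists_filter`) makes both marginals
scalar (`scalar_of_trace_le`). In the magic basis such a state is a real matrix, so it is a mixture,
with weights p_i, of orthonormal real vectors x_i. Testing the partial transpose on one vector per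
x_k shows that no p_k exceeds the sum of the others. Hence the mixture splits into equally weighted
pairs. Each pair is separable because x_i ± i x_j has zero sum of squares, that is, zero
determinant, so it is a product vector.

Dimension 3. Choi's matrix is positive and fixed by the partial transpose, but its range contains no
nonzero product vector (`mul_eq_zero_of_mem_range`), whereas the product vectors of a separable
decomposition lie in the range.

Duality. Under the Choi matrix of a map, positive maps are the Hermitian functionals that are
nonnegative on C_p, and decomposable maps form `pptDualCone`, the dual of C_d. Both `separableCone`
and `pptDualCone` are closed, so Hahn-Banach separation gives each direction of the equivalence. -/

noncomputable section

namespace TensorCones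

open Matrix Kronecker ComplexOrder

/-! ### Closed convex cones in finite dimension. -/

section Cone

variable {E : Type*} [NormedAddCommGroup E] [NormedSpace ℝ E]

/-- The convex cone spanned by a convex base `K`, together with the origin. -/
def coneOver (K : Set E) : Set E := {x | x = 0 ∨ ∃ c : ℝ, 0 < c ∧ ∃ k ∈ K, x = c • k}

lemma coneOver_add_mem {K : Set E} (hK : Convex ℝ K) {x y : E} (hx : x ∈ coneOver K)
    (hy : y ∈ coneOver K) : x + y ∈ coneOver K := by
  rcases hx with rfl | ⟨c, hc, k, hk, rfl⟩
  · simpa using hy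
  rcases hy with rfl | ⟨d, hd, l, hl, rfl⟩
  · exact Or.inr ⟨c, hc, k, hk, by simp⟩
  refine Or.inr ⟨c + d, by positivity, (c / (c + d)) • k + (d / (c + d)) • l,
    hK hk hl (by positivity) (by positivity) (by field_simp), ?_⟩
  rw [smul_add, smul_smul, smul_smul]
  congr 2 <;> field_simp

/-- Since `φ = 1` on the bounded base, `‖x‖ ≤ R * φ x` on the cone. A limit with `φ x = 0` is
therefore zero; otherwise the rescaled sequence `u n / φ (u n)` eventually stays in the compact
base. -/
lemma isClosed_coneOver {K : Set E} (hK : IsCompact K) (φ : E →L[ℝ] ℝ) (hφ : ∀ k ∈ K, φ k = 1) :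
    IsClosed (coneOver K) := by
  obtain ⟨R, hR⟩ := hK.isBounded.exists_norm_le
  have hpos : ∀ x ∈ coneOver K, 0 ≤ φ x := by
    rintro x (rfl | ⟨c, hc, k, hk, rfl⟩)
    · simp
    · simp [hφ k hk, hc.le]
  have hbd : ∀ x ∈ coneOver K, ‖x‖ ≤ R * φ x := by
    rintro x (rfl | ⟨c, hc, k, hk, rfl⟩)
    · simp
    · rw [norm_smul, map_smul, hφ k hk, smul_eq_mul, mul_one, Real.norm_of_nonneg hc.le, mul_comm]
      exact mul_le_mul_of_nonneg_right (hR k hk) hc.le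
  refine isClosed_of_closure_subset fun x hx => ?_
  obtain ⟨u, hu, hux⟩ := mem_closure_iff_seq_limit.1 hx
  have hφu := (φ.continuous.tendsto x).comp hux
  have h0 : 0 ≤ φ x := ge_of_tendsto' hφu fun n => hpos _ (hu n)
  have hx' : ‖x‖ ≤ R * φ x := le_of_tendsto_of_tendsto' hux.norm (hφu.const_mul R)
    fun n => hbd _ (hu n)
  rcases h0.eq_or_lt with h0 | h0
  · left
    rw [← h0, mul_zero] at hx'
    exact norm_le_zero_iff.1 hx'
  · have hlim : Filter.Tendsto (fun n => (φ (u n))⁻¹ • u n) Filter.atTop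
        (nhds ((φ x)⁻¹ • x)) := (hφu.inv₀ h0.ne').smul hux
    have hmem : (φ x)⁻¹ • x ∈ K := by
      refine hK.isClosed.mem_of_tendsto hlim ?_
      filter_upwards [hφu.eventually (lt_mem_nhds h0)] with n hn
      rcases hu n with h | ⟨c, hc, k, hk, h⟩
      · simp [h] at hn
      · rw [h, map_smul, hφ k hk, smul_smul]
        simpa [hc.ne'] using hk
    exact Or.inr ⟨φ x, h0, _, hmem, by rw [smul_smul, mul_inv_cancel₀ h0.ne', one_smul]⟩

/-- In finite dimension the convex hull of a compact set is compact. -/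
lemma isCompact_convexHull_of_finiteDimensional [FiniteDimensional ℝ E] {P : Set E}
    (hP : IsCompact P) : IsCompact (convexHull ℝ P) := by
  let F : ∀ m : ℕ, (Fin m → ℝ) × (Fin m → E) → E := fun m p => ∑ i, p.1 i • p.2 i
  let S : ∀ m : ℕ, Set ((Fin m → ℝ) × (Fin m → E)) :=
    fun m => stdSimplex ℝ (Fin m) ×ˢ Set.pi Set.univ fun _ => P
  -- By Carathéodory, at most `finrank + 1` points are needed, so the hull is a finite union of
  -- continuous images of compact sets.
  have : convexHull ℝ P = ⋃ m ∈ Set.Iic (Module.finrank ℝ E + 1), F m '' S m := by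
    apply Set.Subset.antisymm
    · intro x hx
      obtain ⟨κ, _, z, w, hz, hind, hw, hw1, rfl⟩ := eq_pos_convex_span_of_mem_convexHull hx
      let e := Fintype.equivFin κ
      refine Set.mem_biUnion (x := Fintype.card κ) ?_ ⟨(w ∘ e.symm, z ∘ e.symm), ⟨⟨?_, ?_⟩, ?_⟩, ?_⟩
      · exact (hind.card_le_finrank_succ).trans
          (Nat.succ_le_succ (Submodule.finrank_le _))
      · exact fun i => (hw _).le
      · rw [← hw1]; exact e.symm.sum_comp w
      · exact fun i _ => hz (Set.mem_range_self _)
      · exact e.symm.sum_comp fun i => w i • z i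
    · refine Set.iUnion₂_subset fun m _ => ?_
      rintro _ ⟨⟨w, z⟩, ⟨⟨hw, hw1⟩, hz⟩, rfl⟩
      exact (convex_convexHull ℝ P).sum_mem (fun i _ => hw i) hw1
        fun i _ => subset_convexHull ℝ P (hz i (Set.mem_univ i))
  rw [this]
  refine (Set.finite_Iic _).isCompact_biUnion fun m _ => ?_
  exact ((isCompact_stdSimplex ℝ (Fin m)).prod (isCompact_univ_pi fun _ => hP)).image
    (by fun_prop)

/-- A closed cone can be separated from a point outside of it. -/
lemma exists_dual_of_notMem {S : Set E} (hc : IsClosed S) (h0 : 0 ∈ S)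
    (hadd : ∀ x ∈ S, ∀ y ∈ S, x + y ∈ S) (hsmul : ∀ x ∈ S, ∀ c : ℝ, 0 ≤ c → c • x ∈ S)
    {x : E} (hx : x ∉ S) : ∃ f : E →L[ℝ] ℝ, (∀ y ∈ S, 0 ≤ f y) ∧ f x < 0 := by
  let C : ProperCone ℝ E :=
    { carrier := S
      add_mem' := fun {a b} ha hb => hadd a ha b hb
      zero_mem' := h0
      smul_mem' := fun c y hy => hsmul y hy c.1 c.2
      isClosed' := hc }
  exact C.hyperplane_separation_point hx

end Cone

/-! ### Separable and PPT matrices, closedness of the cones, and the pairing. -/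

section Matrices

attribute [local instance] Matrix.normedAddCommGroup Matrix.normedSpace

variable {ι : Type*}

/-- The partial transpose `id ⊗ t` of a matrix with rows and columns indexed by pairs. -/
def partialTransposeMatrix (ι : Type*) :
    Matrix (ι × ι) (ι × ι) ℂ →ₗ[ℂ] Matrix (ι × ι) (ι × ι) ℂ where
  toFun X := of fun p q => X (p.1, q.2) (q.1, p.2)
  map_add' _ _ := rfl
  map_smul' _ _ := rfl

@[simp] lemma partialTransposeMatrix_apply (X : Matrix (ι × ι) (ι × ι) ℂ) (p q : ι × ι) :
    partialTransposeMatrix ι X p q = X (p.1, q.2) (q.1, p.2) := rfl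

@[simp] lemma partialTransposeMatrix_involutive (X : Matrix (ι × ι) (ι × ι) ℂ) :
    partialTransposeMatrix ι (partialTransposeMatrix ι X) = X := rfl

@[simp] lemma partialTransposeMatrix_kronecker (A B : Matrix ι ι ℂ) :
    partialTransposeMatrix ι (A ⊗ₖ B) = A ⊗ₖ Bᵀ := rfl

variable [Fintype ι]

/-- The matrix version of the projective cone. -/
def separableCone (ι : Type*) [Fintype ι] : Set (Matrix (ι × ι) (ι × ι) ℂ) :=
  {X | ∃ (m : ℕ) (A B : Fin m → Matrix ι ι ℂ), (∀ i, (A i).PosSemidef) ∧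
    (∀ i, (B i).PosSemidef) ∧ X = ∑ i, A i ⊗ₖ B i}

/-- The matrix version of the cone `C_d`. -/
def pptCone (ι : Type*) [Fintype ι] : Set (Matrix (ι × ι) (ι × ι) ℂ) :=
  {X | X.PosSemidef ∧ (partialTransposeMatrix ι X).PosSemidef}

lemma kronecker_mem_separableCone {A B : Matrix ι ι ℂ} (hA : A.PosSemidef) (hB : B.PosSemidef) :
    A ⊗ₖ B ∈ separableCone ι :=
  ⟨1, fun _ => A, fun _ => B, fun _ => hA, fun _ => hB, by simp⟩

lemma separableCone_zero_mem : (0 : Matrix (ι × ι) (ι × ι) ℂ) ∈ separableCone ι :=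
  ⟨0, fun _ => 0, fun _ => 0, fun i => i.elim0, fun i => i.elim0, by simp⟩

lemma separableCone_add_mem {X Y : Matrix (ι × ι) (ι × ι) ℂ} (hX : X ∈ separableCone ι)
    (hY : Y ∈ separableCone ι) : X + Y ∈ separableCone ι := by
  obtain ⟨m, A, B, hA, hB, rfl⟩ := hX
  obtain ⟨k, C, D, hC, hD, rfl⟩ := hY
  refine ⟨m + k, Fin.append A C, Fin.append B D, fun i => ?_, fun i => ?_, ?_⟩
  · induction i using Fin.addCases <;> simp [hA, hC]
  · induction i using Fin.addCases <;> simp [hB, hD]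
  · simp [Fin.sum_univ_add]

lemma posSemidef_real_smul {κ : Type*} [Fintype κ] {A : Matrix κ κ ℂ} (hA : A.PosSemidef) {c : ℝ}
    (hc : 0 ≤ c) : (c • A).PosSemidef :=
  hA.smul hc

lemma separableCone_smul_mem {X : Matrix (ι × ι) (ι × ι) ℂ} (hX : X ∈ separableCone ι) {c : ℝ}
    (hc : 0 ≤ c) : c • X ∈ separableCone ι := by
  obtain ⟨m, A, B, hA, hB, rfl⟩ := hX
  refine ⟨m, fun i => c • A i, B, fun i => posSemidef_real_smul (hA i) hc, hB, ?_⟩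
  rw [Finset.smul_sum]
  exact Finset.sum_congr rfl fun i _ => (smul_kronecker c (A i) (B i)).symm

lemma PosSemidef.kronecker_pair {A B : Matrix ι ι ℂ} (hA : A.PosSemidef) (hB : B.PosSemidef) :
    (A ⊗ₖ B).PosSemidef := by
  classical exact hA.kronecker hB

lemma separableCone_subset_pptCone : separableCone ι ⊆ pptCone ι := by
  rintro X ⟨m, A, B, hA, hB, rfl⟩
  refine ⟨posSemidef_sum _ fun i _ => PosSemidef.kronecker_pair (hA i) (hB i), ?_⟩
  rw [map_sum]
  exact posSemidef_sum _ fun i _ => PosSemidef.kronecker_pair (hA i) (hB i).transpose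

/-- The density matrices. -/
def stateSet (κ : Type*) [Fintype κ] : Set (Matrix κ κ ℂ) := {A | A.PosSemidef ∧ A.trace = 1}

variable {κ : Type*} [Fintype κ]

lemma isClosed_posSemidef : IsClosed {A : Matrix κ κ ℂ | A.PosSemidef} := by
  simp only [posSemidef_iff_dotProduct_mulVec, Set.ofPred_and, Set.ofPred_forall]
  refine IsClosed.inter (isClosed_eq (by fun_prop) continuous_id) (isClosed_iInter fun x => ?_)
  exact isClosed_le continuous_const (by fun_prop)

/-- In a decomposition into rank-one terms, each entry satisfies |v_i v_j| ≤ (|v_i|² + |v_j|²)/2 ≤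
‖v‖², and the trace is the sum of the ‖v‖². This bounds the set of states. -/
lemma norm_le_trace {A : Matrix κ κ ℂ} (hA : A.PosSemidef) : ‖A‖ ≤ A.trace.re := by
  obtain ⟨m, v, rfl⟩ := posSemidef_iff_eq_sum_vecMulVec.1 hA
  have htr : (∑ k, vecMulVec (v k) (star (v k))).trace.re = ∑ k, ∑ i, ‖v k i‖ ^ 2 := by
    simp only [trace_sum, trace_vecMulVec, Complex.re_sum, dotProduct, Pi.star_apply]
    refine Finset.sum_congr rfl fun k _ => Finset.sum_congr rfl fun i _ => ?_
    rw [Complex.star_def, Complex.mul_conj, Complex.ofReal_re, Complex.normSq_eq_norm_sq]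
  rw [htr, Matrix.norm_le_iff (by positivity)]
  intro i j
  rw [Matrix.sum_apply]
  refine (norm_sum_le _ _).trans (Finset.sum_le_sum fun k _ => ?_)
  have h : ∀ i, ‖v k i‖ ^ 2 ≤ ∑ i, ‖v k i‖ ^ 2 := fun i =>
    Finset.single_le_sum (f := fun i => ‖v k i‖ ^ 2) (fun _ _ => by positivity) (Finset.mem_univ i)
  rw [vecMulVec_apply, norm_mul, Pi.star_apply, norm_star]
  nlinarith [h i, h j, sq_nonneg (‖v k i‖ - ‖v k j‖)]

lemma isCompact_stateSet : IsCompact (stateSet κ) := by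
  refine Metric.isCompact_of_isClosed_isBounded ?_ ?_
  · exact isClosed_posSemidef.inter (isClosed_eq (by fun_prop) continuous_const)
  · refine (Metric.isBounded_iff_subset_closedBall 0).2 ⟨1, fun A hA => ?_⟩
    simpa [hA.2] using norm_le_trace hA.1

/-- The real part of the trace. -/
def reTrace (κ : Type*) [Fintype κ] : Matrix κ κ ℂ →L[ℝ] ℝ :=
  LinearMap.toContinuousLinearMap (Complex.reLm ∘ₗ Matrix.traceLinearMap κ ℝ ℂ)

@[simp] lemma reTrace_apply (A : Matrix κ κ ℂ) : reTrace κ A = A.trace.re := rfl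

lemma PosSemidef.eq_zero_or_smul {A : Matrix κ κ ℂ} (hA : A.PosSemidef) :
    A = 0 ∨ ∃ c : ℝ, 0 < c ∧ ∃ B ∈ stateSet κ, A = c • B := by
  have ht := hA.trace_nonneg
  by_cases h : A.trace = 0
  · exact Or.inl (hA.trace_eq_zero_iff.1 h)
  obtain ⟨c, hc⟩ : ∃ c : ℝ, A.trace = c :=
    ⟨A.trace.re, Complex.ext rfl (by simpa using (Complex.le_def.1 ht).2.symm)⟩
  have hc0 : 0 < c := by
    rw [hc] at h ht
    have : 0 ≤ c := by exact_mod_cast ht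
    exact lt_of_le_of_ne this fun h' => h (by simp [← h'])
  refine Or.inr ⟨c, hc0, c⁻¹ • A, ⟨posSemidef_real_smul hA (by positivity), ?_⟩, ?_⟩
  · rw [trace_smul, hc, Complex.real_smul, ← Complex.ofReal_mul, inv_mul_cancel₀ hc0.ne']; simp
  · rw [smul_smul, mul_inv_cancel₀ hc0.ne', one_smul]

/-- It is the cone over the convex hull of the compact set of product states, on which the trace is
1. -/
lemma isClosed_separableCone : IsClosed (separableCone ι) := by
  let P : Set (Matrix (ι × ι) (ι × ι) ℂ) :=
    (fun p : Matrix ι ι ℂ × Matrix ι ι ℂ => p.1 ⊗ₖ p.2) '' (stateSet ι ×ˢ stateSet ι)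
  have hP : IsCompact P := by
    refine (isCompact_stateSet.prod isCompact_stateSet).image ?_
    refine continuous_matrix fun i j => ?_
    simp only [kroneckerMap_apply]
    fun_prop
  have hφ : ∀ k ∈ convexHull ℝ P, reTrace (ι × ι) k = 1 := by
    have : Convex ℝ {k | reTrace (ι × ι) k = 1} :=
      convex_hyperplane (reTrace (ι × ι)).toLinearMap.isLinear 1
    intro k hk
    refine convexHull_min ?_ this hk
    rintro _ ⟨⟨A, B⟩, ⟨hA, hB⟩, rfl⟩
    simp [trace_kronecker, hA.2, hB.2]
  have : separableCone ι = coneOver (convexHull ℝ P) := by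
    apply Set.Subset.antisymm
    · rintro X ⟨m, A, B, hA, hB, rfl⟩
      refine Finset.sum_induction _ (· ∈ coneOver (convexHull ℝ P))
        (fun _ _ => coneOver_add_mem (convex_convexHull ℝ P)) (Or.inl rfl) fun i _ => ?_
      rcases PosSemidef.eq_zero_or_smul (hA i) with h | ⟨c, hc, A', hA', h⟩
      · left; simp [h]
      rcases PosSemidef.eq_zero_or_smul (hB i) with h' | ⟨d, hd, B', hB', h'⟩
      · left; simp [h']
      refine Or.inr ⟨c * d, by positivity, A' ⊗ₖ B', subset_convexHull ℝ P
        ⟨(A', B'), ⟨hA', hB'⟩, rfl⟩, ?_⟩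
      rw [h, h', smul_kronecker, kronecker_smul, smul_smul]
    · have hconv : convexHull ℝ P ⊆ separableCone ι := by
        refine convexHull_min ?_ fun x hx y hy a b ha hb _ =>
          separableCone_add_mem (separableCone_smul_mem hx ha) (separableCone_smul_mem hy hb)
        rintro _ ⟨⟨A, B⟩, ⟨hA, hB⟩, rfl⟩
        exact kronecker_mem_separableCone hA.1 hB.1
      rintro X (rfl | ⟨c, hc, k, hk, rfl⟩)
      · exact separableCone_zero_mem
      · exact separableCone_smul_mem (hconv hk) hc.le
  rw [this]
  exact isClosed_coneOver (isCompact_convexHull_of_finiteDimensional hP) _ hφ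

/-- The matrices `P + (id ⊗ t) Q` with `P` and `Q` positive. -/
def pptDualCone (ι : Type*) [Fintype ι] : Set (Matrix (ι × ι) (ι × ι) ℂ) :=
  {X | ∃ P Q : Matrix (ι × ι) (ι × ι) ℂ, P.PosSemidef ∧ Q.PosSemidef ∧
    X = P + partialTransposeMatrix ι Q}

lemma trace_partialTransposeMatrix (X : Matrix (ι × ι) (ι × ι) ℂ) :
    (partialTransposeMatrix ι X).trace = X.trace := rfl

/-- A sum of two closed cones need not be closed. Here it is, because the partial transpose
preserves the trace: states and their partial transposes span one compact base of trace 1. -/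
lemma isClosed_pptDualCone : IsClosed (pptDualCone ι) := by
  let S : Set (Matrix (ι × ι) (ι × ι) ℂ) := stateSet (ι × ι)
  let Γ := partialTransposeMatrix ι
  have hΓ : Continuous Γ := Γ.continuous_of_finiteDimensional
  have hP : IsCompact (S ∪ Γ '' S) :=
    isCompact_stateSet.union (isCompact_stateSet.image hΓ)
  have hφ : ∀ k ∈ convexHull ℝ (S ∪ Γ '' S), reTrace (ι × ι) k = 1 := by
    have : Convex ℝ {k | reTrace (ι × ι) k = 1} :=
      convex_hyperplane (reTrace (ι × ι)).toLinearMap.isLinear 1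
    intro k hk
    refine convexHull_min ?_ this hk
    rintro _ (hA | ⟨A, hA, rfl⟩)
    · simp [hA.2]
    · simp [Γ, trace_partialTransposeMatrix, hA.2]
  have hconv := convex_convexHull ℝ (S ∪ Γ '' S)
  have : pptDualCone ι = coneOver (convexHull ℝ (S ∪ Γ '' S)) := by
    apply Set.Subset.antisymm
    · rintro X ⟨P, Q, hP, hQ, rfl⟩
      refine coneOver_add_mem hconv ?_ ?_
      · rcases PosSemidef.eq_zero_or_smul hP with h | ⟨c, hc, A, hA, h⟩
        · exact Or.inl h
        · exact Or.inr ⟨c, hc, A, subset_convexHull ℝ _ (Or.inl hA), h⟩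
      · rcases PosSemidef.eq_zero_or_smul hQ with h | ⟨c, hc, A, hA, h⟩
        · left; simp [h]
        · exact Or.inr ⟨c, hc, Γ A, subset_convexHull ℝ _ (Or.inr ⟨A, hA, rfl⟩), by rw [h]; rfl⟩
    · have hc : convexHull ℝ (S ∪ Γ '' S) ⊆ pptDualCone ι := by
        refine convexHull_min ?_ ?_
        · rintro _ (hA | ⟨A, hA, rfl⟩)
          · exact ⟨_, 0, hA.1, PosSemidef.zero, by simp⟩
          · exact ⟨0, A, PosSemidef.zero, hA.1, by simp [Γ]⟩
        · rintro _ ⟨P, Q, hP, hQ, rfl⟩ _ ⟨P', Q', hP', hQ', rfl⟩ a b ha hb -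
          refine ⟨a • P + b • P', a • Q + b • Q',
            (posSemidef_real_smul hP ha).add (posSemidef_real_smul hP' hb),
            (posSemidef_real_smul hQ ha).add (posSemidef_real_smul hQ' hb), ?_⟩
          ext p q
          simp
          ring
      rintro X (rfl | ⟨c, hc', k, hk, rfl⟩)
      · exact ⟨0, 0, PosSemidef.zero, PosSemidef.zero, by simp⟩
      · obtain ⟨P, Q, hP, hQ, rfl⟩ := hc hk
        refine ⟨c • P, c • Q, posSemidef_real_smul hP hc'.le, posSemidef_real_smul hQ hc'.le, ?_⟩
        ext p q
        simp
  rw [this]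
  exact isClosed_coneOver (isCompact_convexHull_of_finiteDimensional hP) _ hφ

/-- The bilinear pairing `∑ C p q * X p q` of matrices. -/
def pairing (C X : Matrix κ κ ℂ) : ℂ := ∑ p, ∑ q, C p q * X p q

lemma pairing_add_left (C D X : Matrix κ κ ℂ) : pairing (C + D) X = pairing C X + pairing D X := by
  simp [pairing, add_mul, Finset.sum_add_distrib]

lemma pairing_partialTransposeMatrix (C X : Matrix (ι × ι) (ι × ι) ℂ) :
    pairing (partialTransposeMatrix ι C) X = pairing C (partialTransposeMatrix ι X) := by
  simp only [pairing, Fintype.sum_prod_type, partialTransposeMatrix_apply]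
  refine Finset.sum_congr rfl fun i _ => ?_
  rw [Finset.sum_comm]
  conv_rhs => rw [Finset.sum_comm]
  refine Finset.sum_congr rfl fun j _ => Finset.sum_comm

/-- The pairing contains no conjugation, which is why the `star` sits on the first factor of the
rank-one matrix. -/
lemma pairing_vecMulVec (C : Matrix κ κ ℂ) (v : κ → ℂ) :
    pairing C (vecMulVec (star v) v) = star v ⬝ᵥ (C *ᵥ v) := by
  simp only [pairing, dotProduct, mulVec, vecMulVec_apply, Finset.mul_sum]
  exact Finset.sum_congr rfl fun i _ => Finset.sum_congr rfl fun j _ => by ring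

/-- Each rank-one term of `X` contributes the quadratic form of `C` at a conjugated vector. -/
lemma pairing_nonneg {C X : Matrix κ κ ℂ} (hC : C.PosSemidef) (hX : X.PosSemidef) :
    0 ≤ pairing C X := by
  obtain ⟨m, v, rfl⟩ := posSemidef_iff_eq_sum_vecMulVec.1 hX
  have : pairing C (∑ i, vecMulVec (v i) (star (v i))) =
      ∑ i, pairing C (vecMulVec (v i) (star (v i))) := by
    simp only [pairing, Matrix.sum_apply, Finset.mul_sum]
    rw [Finset.sum_comm]
    conv_lhs => enter [2, p]; rw [Finset.sum_comm]
    conv_lhs => rw [Finset.sum_comm]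
    conv_rhs => enter [2, p]; rw [Finset.sum_comm]
  rw [this]
  refine Finset.sum_nonneg fun i _ => ?_
  have := pairing_vecMulVec C (star (v i))
  rw [star_star] at this
  rw [this]
  simpa using hC.dotProduct_mulVec_nonneg (star (v i))

/-- Every real functional is the real part of the pairing with a matrix. -/
lemma exists_eq_re_pairing [DecidableEq κ] (f : Matrix κ κ ℂ →L[ℝ] ℝ) :
    ∃ C : Matrix κ κ ℂ, ∀ X, f X = (pairing C X).re := by
  -- The minus sign compensates the one in Re(cx) = Re c Re x − Im c Im x.
  refine ⟨of fun p q => ⟨f (single p q 1), -f (single p q Complex.I)⟩, fun X => ?_⟩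
  have h : ∀ p q, f (single p q (X p q)) =
      (X p q).re * f (single p q 1) + (X p q).im * f (single p q Complex.I) := by
    intro p q
    rw [← smul_eq_mul, ← smul_eq_mul, ← map_smul, ← map_smul, ← map_add, smul_single, smul_single,
      ← single_add]
    congr 2
    simp
  conv_lhs => rw [matrix_eq_sum_single X]
  simp only [map_sum, h, pairing, Complex.re_sum, Complex.mul_re, of_apply]
  exact Finset.sum_congr rfl fun i _ => Finset.sum_congr rfl fun j _ => by ring

/-- On Hermitian matrices a real functional is the pairing with a Hermitian matrix. -/
lemma exists_isHermitian_eq_pairing [DecidableEq κ] (f : Matrix κ κ ℂ →L[ℝ] ℝ) :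
    ∃ C : Matrix κ κ ℂ, C.IsHermitian ∧ ∀ X : Matrix κ κ ℂ, X.IsHermitian →
      pairing C X = ((2 * f X : ℝ) : ℂ) := by
  obtain ⟨C, hC⟩ := exists_eq_re_pairing f
  -- On Hermitian `X` the pairing with `Cᴴ` is the conjugate of the pairing with `C`; their sum is
  -- twice the real part, hence the factor 2.
  refine ⟨C + Cᴴ, isHermitian_add_transpose_self C, fun X hX => ?_⟩
  have : pairing Cᴴ X = star (pairing C X) := by
    simp only [pairing, star_sum, star_mul', conjTranspose_apply]
    rw [Finset.sum_comm]
    refine Finset.sum_congr rfl fun p _ => Finset.sum_congr rfl fun q _ => ?_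
    rw [← hX.apply q p]
  rw [pairing_add_left, this, hC]
  exact Complex.add_conj _

end Matrices

/-! ### Invariance of both cones under local filters. -/

section Filtering

variable {ι : Type*} [Fintype ι]

lemma kronecker_conj_mem_separableCone {X : Matrix (ι × ι) (ι × ι) ℂ} (hX : X ∈ separableCone ι)
    (A B : Matrix ι ι ℂ) : (A ⊗ₖ B) * X * (A ⊗ₖ B)ᴴ ∈ separableCone ι := by
  obtain ⟨m, C, D, hC, hD, rfl⟩ := hX
  refine ⟨m, fun i => A * C i * Aᴴ, fun i => B * D i * Bᴴ,
    fun i => (hC i).mul_mul_conjTranspose_same A, fun i => (hD i).mul_mul_conjTranspose_same B, ?_⟩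
  simp only [Finset.mul_sum, Finset.sum_mul, conjTranspose_kronecker, ← mul_kronecker_mul]

lemma eq_sum_smul_kronecker [DecidableEq ι] (X : Matrix (ι × ι) (ι × ι) ℂ) :
    X = ∑ p : ι × ι, ∑ q : ι × ι,
      X p q • (single p.1 q.1 (1 : ℂ) ⊗ₖ single p.2 q.2 (1 : ℂ)) := by
  conv_lhs => rw [matrix_eq_sum_single X]
  refine Finset.sum_congr rfl fun p _ => Finset.sum_congr rfl fun q _ => ?_
  rw [single_kronecker_single, smul_single]
  simp

/-- On a product, (B D Bᴴ)ᵀ is the congruence of Dᵀ by the conjugate of B; linearity does the rest.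
-/
lemma partialTransposeMatrix_kronecker_conj (X : Matrix (ι × ι) (ι × ι) ℂ) (A B : Matrix ι ι ℂ) :
    partialTransposeMatrix ι ((A ⊗ₖ B) * X * (A ⊗ₖ B)ᴴ) =
      (A ⊗ₖ B.map star) * partialTransposeMatrix ι X * (A ⊗ₖ B.map star)ᴴ := by
  classical
  have key : ∀ C D : Matrix ι ι ℂ,
      partialTransposeMatrix ι ((A ⊗ₖ B) * (C ⊗ₖ D) * (A ⊗ₖ B)ᴴ) =
      (A ⊗ₖ B.map star) * partialTransposeMatrix ι (C ⊗ₖ D) * (A ⊗ₖ B.map star)ᴴ := by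
    intro C D
    simp only [conjTranspose_kronecker, ← mul_kronecker_mul, partialTransposeMatrix_kronecker,
      transpose_mul, Matrix.mul_assoc]
    congr 3
    ext i j
    simp
  rw [eq_sum_smul_kronecker X]
  simp only [Finset.mul_sum, Finset.sum_mul, map_sum, Matrix.mul_smul, Matrix.smul_mul, map_smul,
    key]

lemma kronecker_conj_mem_pptCone {X : Matrix (ι × ι) (ι × ι) ℂ} (hX : X ∈ pptCone ι)
    (A B : Matrix ι ι ℂ) : (A ⊗ₖ B) * X * (A ⊗ₖ B)ᴴ ∈ pptCone ι := by
  refine ⟨hX.1.mul_mul_conjTranspose_same _, ?_⟩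
  rw [partialTransposeMatrix_kronecker_conj]
  exact hX.2.mul_mul_conjTranspose_same _

end Filtering

/-! ### Two qubits: product vectors and trace-minimal filters. -/

section Qubits

attribute [local instance] Matrix.normedAddCommGroup Matrix.normedSpace

/-- A vector of `ℂ² ⊗ ℂ²` with vanishing determinant is a product vector. -/
lemma exists_eq_mul_of_det_eq_zero {v : Fin 2 × Fin 2 → ℂ}
    (hv : v (0, 0) * v (1, 1) = v (0, 1) * v (1, 0)) :
    ∃ f g : Fin 2 → ℂ, ∀ p, v p = f p.1 * g p.2 := by
  by_cases h0 : v (0, 0) = 0 ∧ v (0, 1) = 0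
  · refine ⟨![0, 1], ![v (1, 0), v (1, 1)], fun p => ?_⟩
    obtain ⟨i, j⟩ := p
    fin_cases i <;> fin_cases j <;> simp [h0]
  · by_cases h : v (0, 0) = 0
    · have h1 : v (0, 1) ≠ 0 := fun h' => h0 ⟨h, h'⟩
      have h2 : v (1, 0) = 0 := by
        rw [h, zero_mul] at hv
        exact (mul_eq_zero.1 hv.symm).resolve_left h1
      refine ⟨![1, v (1, 1) / v (0, 1)], ![0, v (0, 1)], fun p => ?_⟩
      obtain ⟨i, j⟩ := p
      fin_cases i <;> fin_cases j <;> simp [h, h1, h2]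
    · refine ⟨![1, v (1, 0) / v (0, 0)], ![v (0, 0), v (0, 1)], fun p => ?_⟩
      obtain ⟨i, j⟩ := p
      fin_cases i <;> fin_cases j <;> simp [h]
      field_simp
      linear_combination hv

lemma vecMulVec_mem_separableCone {ι : Type*} [Fintype ι] {v : ι × ι → ℂ} {f g : ι → ℂ}
    (hv : ∀ p, v p = f p.1 * g p.2) : vecMulVec v (star v) ∈ separableCone ι := by
  have : vecMulVec v (star v) = vecMulVec f (star f) ⊗ₖ vecMulVec g (star g) := by
    ext p q
    simp only [vecMulVec_apply, kroneckerMap_apply, Pi.star_apply, hv, star_mul']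
    ring
  rw [this]
  exact kronecker_mem_separableCone (posSemidef_vecMulVec_self_star f)
    (posSemidef_vecMulVec_self_star g)

lemma trace_conj_pos {κ : Type*} [Fintype κ] {X G : Matrix κ κ ℂ} (hX : X.PosDef) (hG : G ≠ 0) :
    0 < (G * X * Gᴴ).trace.re := by
  have h := hX.posSemidef.mul_mul_conjTranspose_same G
  have h0 := h.trace_nonneg
  have hne : (G * X * Gᴴ).trace ≠ 0 := by
    intro h1
    rw [h.trace_eq_zero_iff] at h1
    obtain ⟨p, hp⟩ := Function.ne_iff.1 hG
    have h2 := hX.dotProduct_mulVec_pos (x := star (G p)) (star_ne_zero.2 hp)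
    -- A diagonal entry is the quadratic form of `X` at the conjugate of a nonzero row of `G`.
    have h3 : (G * X * Gᴴ) p p = star (star (G p)) ⬝ᵥ (X *ᵥ star (G p)) := by
      rw [star_star, Matrix.mul_assoc, mul_apply]
      rfl
    rw [← h3, h1] at h2
    simp at h2
  have := lt_of_le_of_ne h0 hne.symm
  exact (Complex.lt_def.1 this).1

/-- For 2 × 2 matrices the product of the determinants scales by the same `a ^ 2 * b ^ 2`, so its
ratio to the trace is scale invariant and can be maximized over unit spheres. -/
lemma trace_kronecker_conj_smul (X : Matrix (Fin 2 × Fin 2) (Fin 2 × Fin 2) ℂ)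
    (A B : Matrix (Fin 2) (Fin 2) ℂ) (a b : ℝ) :
    (((a • A) ⊗ₖ (b • B)) * X * ((a • A) ⊗ₖ (b • B))ᴴ).trace.re =
      a ^ 2 * b ^ 2 * ((A ⊗ₖ B) * X * (A ⊗ₖ B)ᴴ).trace.re := by
  rw [smul_kronecker, kronecker_smul, smul_smul, conjTranspose_smul, Matrix.smul_mul,
    Matrix.smul_mul, Matrix.mul_smul, smul_smul, trace_smul, Complex.smul_re, star_trivial,
    smul_eq_mul]
  ring

lemma norm_det_smul (A : Matrix (Fin 2) (Fin 2) ℂ) (a : ℝ) : ‖(a • A).det‖ = a ^ 2 * ‖A.det‖ := by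
  have : (a • A).det = ((a ^ 2 : ℝ) : ℂ) * A.det := by
    simp
  rw [this, norm_mul, Complex.norm_real, Real.norm_of_nonneg (by positivity)]

/-- A positive definite matrix on `ℂ² ⊗ ℂ²` can be filtered locally into one whose trace is
minimal in its orbit under pairs of matrices of determinant one. -/
lemma exists_filter {X : Matrix (Fin 2 × Fin 2) (Fin 2 × Fin 2) ℂ} (hX : X.PosDef) :
    ∃ A B : Matrix (Fin 2) (Fin 2) ℂ, IsUnit A.det ∧ IsUnit B.det ∧
      ∀ C D : Matrix (Fin 2) (Fin 2) ℂ,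
        ‖C.det‖ * ‖D.det‖ * ((A ⊗ₖ B) * X * (A ⊗ₖ B)ᴴ).trace.re ≤
          ((C ⊗ₖ D) * ((A ⊗ₖ B) * X * (A ⊗ₖ B)ᴴ) * (C ⊗ₖ D)ᴴ).trace.re := by
  let f : Matrix (Fin 2) (Fin 2) ℂ × Matrix (Fin 2) (Fin 2) ℂ → ℝ :=
    fun p => ((p.1 ⊗ₖ p.2) * X * (p.1 ⊗ₖ p.2)ᴴ).trace.re
  let S : Set (Matrix (Fin 2) (Fin 2) ℂ) := Metric.sphere 0 1
  have hS : IsCompact S := isCompact_sphere 0 1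
  have hne : ∀ A B : Matrix (Fin 2) (Fin 2) ℂ, A ≠ 0 → B ≠ 0 → A ⊗ₖ B ≠ 0 := by
    intro A B hA hB h
    obtain ⟨i, hi⟩ := Function.ne_iff.1 hA
    obtain ⟨j, hj⟩ := Function.ne_iff.1 hi
    obtain ⟨k, hk⟩ := Function.ne_iff.1 hB
    obtain ⟨l, hl⟩ := Function.ne_iff.1 hk
    have := congrFun (congrFun h (i, k)) (j, l)
    rw [kroneckerMap_apply] at this
    exact (mul_ne_zero hj hl) this
  have hf : ∀ A B : Matrix (Fin 2) (Fin 2) ℂ, A ≠ 0 → B ≠ 0 → 0 < f (A, B) := fun A B hA hB =>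
    trace_conj_pos hX (hne A B hA hB)
  have hS0 : ∀ A ∈ S, A ≠ 0 := fun A hA => ne_zero_of_mem_unit_sphere ⟨A, hA⟩
  have hkron : Continuous fun p : Matrix (Fin 2) (Fin 2) ℂ × Matrix (Fin 2) (Fin 2) ℂ =>
      p.1 ⊗ₖ p.2 := by
    refine continuous_matrix fun i j => ?_
    simp only [kroneckerMap_apply]
    fun_prop
  have hfc : Continuous f := by
    refine Complex.continuous_re.comp (Continuous.matrix_trace ?_)
    exact (hkron.matrix_mul continuous_const).matrix_mul hkron.matrix_conjTranspose
  obtain ⟨A₁, hA₁⟩ : S.Nonempty := NormedSpace.sphere_nonempty.2 zero_le_one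
  obtain ⟨⟨A, B⟩, ⟨hA, hB⟩, hmax⟩ := (hS.prod hS).exists_isMaxOn ⟨(A₁, A₁), hA₁, hA₁⟩
    (f := fun p => ‖p.1.det‖ * ‖p.2.det‖ / f p)
    (ContinuousOn.div (by fun_prop) hfc.continuousOn
      fun p hp => (hf p.1 p.2 (hS0 _ hp.1) (hS0 _ hp.2)).ne')
  have hfAB := hf A B (hS0 _ hA) (hS0 _ hB)
  have main : ∀ C D : Matrix (Fin 2) (Fin 2) ℂ,
      ‖C.det‖ * ‖D.det‖ * f (A, B) ≤ ‖A.det‖ * ‖B.det‖ * f (C, D) := by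
    intro C D
    by_cases hC : C = 0
    · simp [hC, f]
    by_cases hD : D = 0
    · simp [hD, f]
    have hc := norm_pos_iff.2 hC
    have hd := norm_pos_iff.2 hD
    have hm := hmax (a := (‖C‖⁻¹ • C, ‖D‖⁻¹ • D)) ⟨by simp [S, norm_smul, hC],
      by simp [S, norm_smul, hD]⟩
    have hfs : f (‖C‖⁻¹ • C, ‖D‖⁻¹ • D) = ‖C‖⁻¹ ^ 2 * ‖D‖⁻¹ ^ 2 * f (C, D) :=
      trace_kronecker_conj_smul X C D _ _
    have hfCD := hf C D hC hD
    simp only [Set.mem_ofPred_eq] at hm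
    rw [hfs, norm_det_smul, norm_det_smul] at hm
    have e : ‖C‖⁻¹ ^ 2 * ‖C.det‖ * (‖D‖⁻¹ ^ 2 * ‖D.det‖) /
        (‖C‖⁻¹ ^ 2 * ‖D‖⁻¹ ^ 2 * f (C, D)) = ‖C.det‖ * ‖D.det‖ / f (C, D) := by
      field_simp
    rw [e, div_le_div_iff₀ hfCD hfAB] at hm
    exact hm
  have h1 := main 1 1
  -- Comparison with the identity pair shows that the maximal ratio is positive, so the maximizer is
  -- invertible.
  rw [det_one, norm_one, one_mul, one_mul] at h1
  have hpos : 0 < ‖A.det‖ * ‖B.det‖ := by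
    by_contra hn
    have h2 : ‖A.det‖ * ‖B.det‖ = 0 := le_antisymm (not_lt.1 hn) (by positivity)
    rw [h2, zero_mul] at h1
    exact absurd hfAB (not_lt.2 h1)
  refine ⟨A, B, isUnit_iff_ne_zero.2 fun h => by simp [h] at hpos,
    isUnit_iff_ne_zero.2 fun h => by simp [h] at hpos, fun C D => ?_⟩
  -- Multiplicativity of the determinant moves the minimum from `(A, B)` to the identity pair for
  -- the filtered matrix.
  have h := main (C * A) (D * B)
  have e : f (C * A, D * B) =
      ((C ⊗ₖ D) * ((A ⊗ₖ B) * X * (A ⊗ₖ B)ᴴ) * (C ⊗ₖ D)ᴴ).trace.re := by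
    simp only [f, mul_kronecker_mul, conjTranspose_mul, Matrix.mul_assoc]
  rw [e, det_mul, det_mul, norm_mul, norm_mul] at h
  refine le_of_mul_le_mul_left ?_ hpos
  calc _ = ‖C.det‖ * ‖A.det‖ * (‖D.det‖ * ‖B.det‖) * f (A, B) := by simp only [f]; ring
    _ ≤ _ := h

lemma trace_conj_fin_two (A M : Matrix (Fin 2) (Fin 2) ℂ) :
    (A * M * Aᴴ).trace = ∑ i, ∑ k, ∑ j, A i j * M j k * star (A i k) := by
  simp only [trace, diag_apply, mul_apply, conjTranspose_apply, Finset.sum_mul]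

/-- A positive `2 × 2` matrix whose trace is minimal among its congruences by matrices of
determinant one is scalar. -/
lemma scalar_of_trace_le {M : Matrix (Fin 2) (Fin 2) ℂ} (hM : M.PosSemidef)
    (h : ∀ A : Matrix (Fin 2) (Fin 2) ℂ, ‖A.det‖ * M.trace.re ≤ (A * M * Aᴴ).trace.re) :
    M 0 0 = M 1 1 ∧ M 0 1 = 0 := by
  have hre : ∀ i, 0 ≤ (M i i).re ∧ (M i i).im = 0 := fun i =>
    ⟨(Complex.le_def.1 hM.diag_nonneg).1, (Complex.le_def.1 hM.diag_nonneg).2.symm⟩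
  have hd : ∀ s t : ℝ, 0 ≤ s → 0 ≤ t →
      s * t * ((M 0 0).re + (M 1 1).re) ≤ s ^ 2 * (M 0 0).re + t ^ 2 * (M 1 1).re := by
    intro s t hs ht
    have := h !![(s : ℂ), 0; 0, (t : ℂ)]
    rw [trace_conj_fin_two] at this
    simp [det_fin_two, trace_fin_two, abs_of_nonneg hs, abs_of_nonneg ht] at this
    linarith
  have ha := (hre 0).1
  have hb := (hre 1).1
  -- Write a, b for the diagonal entries. These choices minimize the gap in `hd` over t and over s
  -- respectively, and give b(a − b)² ≤ 0 and a(a − b)² ≤ 0.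
  have h1 := hd (2 * (M 1 1).re) ((M 0 0).re + (M 1 1).re) (by positivity) (by positivity)
  have h2 := hd ((M 0 0).re + (M 1 1).re) (2 * (M 0 0).re) (by positivity) (by positivity)
  -- A shear with parameter −t `M 0 1` changes the trace by t|`M 0 1`|²(tb − 2), with b the entry `M
  -- 1 1`. Taking t = 1/(1 + b) keeps tb ≤ 1 and allows b = 0.
  have hc := h !![1, -((1 / (1 + (M 1 1).re) : ℝ) : ℂ) * M 0 1; 0, 1]
  have h10 : M 1 0 = star (M 0 1) := (hM.isHermitian.apply 1 0).symm
  constructor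
  · refine Complex.ext ?_ ((hre 0).2.trans (hre 1).2.symm)
    have h3 : ((M 0 0).re + (M 1 1).re) * ((M 0 0).re - (M 1 1).re) ^ 2 ≤ 0 := by nlinarith
    by_contra hne
    have h4 : 0 < ((M 0 0).re - (M 1 1).re) ^ 2 := by
      have := sub_ne_zero.2 hne
      positivity
    have h5 : 0 < (M 0 0).re + (M 1 1).re := by
      rcases ha.eq_or_lt with h' | h'
      · rcases hb.eq_or_lt with h'' | h''
        · exact absurd (h'.symm.trans h'') hne
        · linarith
      · linarith
    nlinarith
  · set t : ℝ := 1 / (1 + (M 1 1).re) with ht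
    have htpos : 0 < t := by positivity
    have htb : t * (M 1 1).re ≤ 1 := by
      rw [ht, div_mul_eq_mul_div, one_mul, div_le_one (by positivity)]
      linarith
    rw [trace_conj_fin_two] at hc
    simp [det_fin_two, trace_fin_two, h10, (hre 1).2] at hc
    have h6 : t * ((M 0 1).re ^ 2 + (M 0 1).im ^ 2) ≤ 0 := by
      have : 0 ≤ (1 - t * (M 1 1).re) * (t * ((M 0 1).re ^ 2 + (M 0 1).im ^ 2)) :=
        mul_nonneg (by linarith) (by positivity)
      nlinarith
    have h7 : (M 0 1).re ^ 2 + (M 0 1).im ^ 2 ≤ 0 := by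
      by_contra hn
      have := mul_pos htpos (not_le.1 hn)
      linarith
    refine Complex.ext ?_ ?_
    · simp; nlinarith [sq_nonneg (M 0 1).re, sq_nonneg (M 0 1).im]
    · simp; nlinarith [sq_nonneg (M 0 1).re, sq_nonneg (M 0 1).im]

end Qubits

/-! ### The magic basis, and PPT implies separable for two qubits. -/

section Magic

/-- The magic basis of `ℂ² ⊗ ℂ²`: in its coordinates, the determinant
of a vector is the sum of the squares. -/
def magicMatrix : Matrix (Fin 2 × Fin 2) (Fin 4) ℂ := of fun p =>
  ![![![1, Complex.I, 0, 0], ![0, 0, Complex.I, 1]],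
    ![![0, 0, Complex.I, -1], ![1, -Complex.I, 0, 0]]] p.1 p.2

lemma magicMatrix_mulVec (z : Fin 4 → ℂ) :
    (magicMatrix *ᵥ z) (0, 0) = z 0 + Complex.I * z 1 ∧
    (magicMatrix *ᵥ z) (0, 1) = Complex.I * z 2 + z 3 ∧
    (magicMatrix *ᵥ z) (1, 0) = Complex.I * z 2 - z 3 ∧
    (magicMatrix *ᵥ z) (1, 1) = z 0 - Complex.I * z 1 := by
  simp [magicMatrix, mulVec, dotProduct, Fin.sum_univ_four, sub_eq_add_neg]

lemma magicMatrix_mul_conjTranspose : magicMatrix * magicMatrixᴴ = (2 : ℂ) • 1 := by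
  ext ⟨i, j⟩ ⟨k, l⟩
  fin_cases i <;> fin_cases j <;> fin_cases k <;> fin_cases l <;>
    simp [magicMatrix, mul_apply, Fin.sum_univ_four, one_apply] <;> norm_num

/-- The state with vector of magic coordinates `z`. -/
def magicState (z : Fin 4 → ℂ) : Matrix (Fin 2 × Fin 2) (Fin 2 × Fin 2) ℂ :=
  vecMulVec (magicMatrix *ᵥ z) (star (magicMatrix *ᵥ z))

lemma magicState_mem_separableCone {z : Fin 4 → ℂ} (hz : ∑ k, z k ^ 2 = 0) :
    magicState z ∈ separableCone (Fin 2) := by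
  obtain ⟨h0, h1, h2, h3⟩ := magicMatrix_mulVec z
  obtain ⟨f, g, h⟩ := exists_eq_mul_of_det_eq_zero (v := magicMatrix *ᵥ z) (by
    rw [h0, h1, h2, h3]
    rw [Fin.sum_univ_four] at hz
    linear_combination hz + (-z 1 ^ 2 - z 2 ^ 2) * Complex.I_sq)
  exact vecMulVec_mem_separableCone h

/-- An equal mixture of two orthogonal real magic states is separable. -/
lemma magicState_add_mem_separableCone {x y : Fin 4 → ℝ} (hxy : x ⬝ᵥ y = 0)
    (h : x ⬝ᵥ x = y ⬝ᵥ y) :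
    magicState (fun k => (x k : ℂ)) + magicState (fun k => (y k : ℂ)) ∈ separableCone (Fin 2) := by
  let X : Fin 4 → ℂ := fun k => (x k : ℂ)
  let Y : Fin 4 → ℂ := fun k => (y k : ℂ)
  -- For orthogonal `x`, `y` of equal length, x ± iy is isotropic, hence a product vector; in the
  -- equal mixture of the two the cross terms cancel.
  have hp : ∀ e : ℂ, e ^ 2 = -1 → ∑ k, (X + e • Y) k ^ 2 = 0 := by
    intro e he
    have h1 : ∑ k, X k * Y k = 0 := by
      simpa [dotProduct] using congrArg (Complex.ofReal) hxy
    have h2 : ∑ k, X k * X k = ∑ k, Y k * Y k := by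
      simpa [dotProduct] using congrArg (Complex.ofReal) h
    have : ∀ k, (X + e • Y) k ^ 2 = X k * X k + 2 * e * (X k * Y k) + e ^ 2 * (Y k * Y k) := by
      intro k; simp only [Pi.add_apply, Pi.smul_apply, smul_eq_mul]; ring
    simp only [this, Finset.sum_add_distrib, ← Finset.mul_sum, h1, h2, he]
    ring
  have key : magicState X + magicState Y =
      (1 / 2 : ℝ) • (magicState (X + Complex.I • Y) + magicState (X + (-Complex.I) • Y)) := by
    ext p q
    simp only [magicState, mulVec_add, mulVec_smul, vecMulVec_apply, Matrix.add_apply,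
      Matrix.smul_apply, Pi.add_apply, Pi.smul_apply, Pi.star_apply, star_add, smul_eq_mul,
      star_mul', star_neg, Complex.star_def, Complex.conj_I, Complex.real_smul]
    push_cast
    linear_combination (magicMatrix *ᵥ Y) p * (starRingEnd ℂ) ((magicMatrix *ᵥ Y) q) *
      Complex.I_sq
  rw [key]
  exact separableCone_smul_mem (separableCone_add_mem
    (magicState_mem_separableCone (hp _ Complex.I_sq))
    (magicState_mem_separableCone (hp _ (by rw [neg_sq, Complex.I_sq])))) (by norm_num)

/-- The vector used to test positivity of the partial transpose against a magic state. -/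
def magicWitness (x : Fin 4 → ℝ) : Fin 2 × Fin 2 → ℂ := fun p =>
  ![![Complex.I * x 2 + x 3, -x 0 - Complex.I * x 1],
    ![x 0 - Complex.I * x 1, -Complex.I * x 2 + x 3]] p.1 p.2

/-- With v and w read as matrices V, W and N = W Vᵀ, the form is the sum of N_ik times the conjugate
of N_ki. -/
lemma dotProduct_partialTransposeMatrix_vecMulVec {ι : Type*} [Fintype ι] (v w : ι × ι → ℂ) :
    star v ⬝ᵥ (partialTransposeMatrix ι (vecMulVec w (star w)) *ᵥ v) =
      ∑ i, ∑ k, (∑ l, w (i, l) * v (k, l)) * star (∑ l, w (k, l) * v (i, l)) := by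
  simp only [dotProduct, mulVec, Fintype.sum_prod_type, partialTransposeMatrix_apply,
    vecMulVec_apply, Pi.star_apply, star_sum, star_mul', Finset.mul_sum, Finset.sum_mul]
  refine Finset.sum_congr rfl fun i _ => ?_
  rw [Finset.sum_comm]
  refine Finset.sum_congr rfl fun k _ => Finset.sum_congr rfl fun j _ =>
    Finset.sum_congr rfl fun l _ => by ring

/-- The witness is the magic vector of `x` with a quarter turn applied to the second factor. For
unit vectors the value is 2 if `y` is orthogonal to `x` and −2 if `y = x`, so the test isolates one
weight. -/
lemma magicWitness_quadraticForm (x y : Fin 4 → ℝ) :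
    (star (magicWitness x) ⬝ᵥ (partialTransposeMatrix (Fin 2)
      (magicState fun k => (y k : ℂ)) *ᵥ magicWitness x)).re =
      2 * (x ⬝ᵥ x) * (y ⬝ᵥ y) - 4 * (x ⬝ᵥ y) ^ 2 := by
  obtain ⟨h0, h1, h2, h3⟩ := magicMatrix_mulVec fun k => (y k : ℂ)
  rw [magicState, dotProduct_partialTransposeMatrix_vecMulVec]
  simp only [Fin.sum_univ_two, h0, h1, h2, h3, dotProduct, Fin.sum_univ_four]
  simp [magicWitness]
  ring

lemma sum_smul_mem_of_pairs_of_monotone {E : Type*} [AddCommGroup E] [Module ℝ E] {S : Set E}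
    (hadd : ∀ x ∈ S, ∀ y ∈ S, x + y ∈ S)
    (hsmul : ∀ x ∈ S, ∀ c : ℝ, 0 ≤ c → c • x ∈ S) (u : Fin 4 → E)
    (hu : ∀ i j, i ≠ j → u i + u j ∈ S) (p : Fin 4 → ℝ) (hp : ∀ i, 0 ≤ p i) (hm : Monotone p)
    (hs : 2 * p 3 ≤ ∑ i, p i) : ∑ i, p i • u i ∈ S := by
  rw [Fin.sum_univ_four] at hs ⊢
  have h01 : p 0 ≤ p 1 := hm (by decide)
  have h12 : p 1 ≤ p 2 := hm (by decide)
  have h23 : p 2 ≤ p 3 := hm (by decide)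
  have := hp 0
  -- `s` is the total weight of the pairs avoiding the largest index 3. All of them use index 2; `r`
  -- goes to the pair with index 0 and `s - r` to the pair with index 1.
  obtain ⟨s, hsdef⟩ : ∃ s, s = (p 0 + p 1 + p 2 - p 3) / 2 := ⟨_, rfl⟩
  obtain ⟨r, hr0, hr1, hr2, hr3⟩ : ∃ r, 0 ≤ r ∧ r ≤ p 0 ∧ r ≤ s ∧ s - r ≤ p 1 := by
    rcases le_total (p 0) s with h | h
    · exact ⟨p 0, by linarith, le_rfl, h, by linarith⟩
    · exact ⟨s, by linarith, h, le_rfl, by linarith⟩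
  have key : p 0 • u 0 + p 1 • u 1 + p 2 • u 2 + p 3 • u 3 =
      (p 2 - s) • (u 3 + u 2) + ((p 1 - (s - r)) • (u 3 + u 1) + ((p 0 - r) • (u 3 + u 0) +
        ((s - r) • (u 2 + u 1) + r • (u 2 + u 0)))) := by
    have h3 : p 3 = p 0 + p 1 + p 2 - 2 * s := by linarith
    rw [h3]
    module
  rw [key]
  refine hadd _ (hsmul _ (hu _ _ (by decide)) _ (by linarith)) _ (hadd _
    (hsmul _ (hu _ _ (by decide)) _ (by linarith)) _ (hadd _
    (hsmul _ (hu _ _ (by decide)) _ (by linarith)) _ (hadd _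
    (hsmul _ (hu _ _ (by decide)) _ (by linarith)) _
    (hsmul _ (hu _ _ (by decide)) _ hr0))))

/-- A nonnegative combination of four vectors in which no coefficient exceeds the sum of the
others is a nonnegative combination of sums of pairs. -/
lemma sum_smul_mem_of_pairs {E : Type*} [AddCommGroup E] [Module ℝ E] {S : Set E}
    (hadd : ∀ x ∈ S, ∀ y ∈ S, x + y ∈ S)
    (hsmul : ∀ x ∈ S, ∀ c : ℝ, 0 ≤ c → c • x ∈ S) (u : Fin 4 → E)
    (hu : ∀ i j, i ≠ j → u i + u j ∈ S) (p : Fin 4 → ℝ) (hp : ∀ i, 0 ≤ p i)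
    (hs : ∀ k, 2 * p k ≤ ∑ i, p i) : ∑ i, p i • u i ∈ S := by
  have := sum_smul_mem_of_pairs_of_monotone hadd hsmul (u ∘ Tuple.sort p)
    (fun i j hij => hu _ _ ((Tuple.sort p).injective.ne hij)) (p ∘ Tuple.sort p) (fun i => hp _)
    (Tuple.monotone_sort p) (by
      rw [show ∑ i, (p ∘ Tuple.sort p) i = ∑ i, p i from Equiv.sum_comp (Tuple.sort p) p]
      exact hs _)
  rwa [show ∑ i, (p ∘ Tuple.sort p) i • (u ∘ Tuple.sort p) i = ∑ i, p i • u i from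
    Equiv.sum_comp (Tuple.sort p) fun i => p i • u i] at this

/-- A state with scalar marginals is a mixture of orthonormal real magic states. -/
lemma exists_magic_decomposition {X : Matrix (Fin 2 × Fin 2) (Fin 2 × Fin 2) ℂ}
    (hX : X.PosSemidef)
    (h1 : X (0, 0) (0, 0) + X (0, 1) (0, 1) = X (1, 0) (1, 0) + X (1, 1) (1, 1))
    (h2 : X (0, 0) (1, 0) + X (0, 1) (1, 1) = 0)
    (h3 : X (0, 0) (0, 0) + X (1, 0) (1, 0) = X (0, 1) (0, 1) + X (1, 1) (1, 1))
    (h4 : X (0, 0) (0, 1) + X (1, 0) (1, 1) = 0) :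
    ∃ (p : Fin 4 → ℝ) (x : Fin 4 → Fin 4 → ℝ), (∀ i, 0 ≤ p i) ∧ (∀ i, x i ⬝ᵥ x i = 1) ∧
      (∀ i j, i ≠ j → x i ⬝ᵥ x j = 0) ∧ X = ∑ i, p i • magicState fun k => (x i k : ℂ) := by
  let Y : Matrix (Fin 4) (Fin 4) ℂ := magicMatrixᴴ * X * magicMatrix
  have hY : Y.PosSemidef := hX.conjTranspose_mul_mul_same _
  -- Scalar marginals make `X` invariant under the spin flip, which in magic coordinates is
  -- entrywise conjugation.
  have hreal : ∀ i j, star (Y i j) = Y i j := by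
    have hc : ∀ p q, (starRingEnd ℂ) (X p q) = X q p := fun p q => hX.isHermitian.apply q p
    have e1 : X (1, 1) (1, 1) = X (0, 0) (0, 0) := by linear_combination (-h1 - h3) / 2
    have e2 : X (1, 0) (1, 0) = X (0, 1) (0, 1) := by linear_combination (h3 - h1) / 2
    have e3 : X (0, 1) (1, 1) = -X (0, 0) (1, 0) := by linear_combination h2
    have e4 : X (1, 0) (1, 1) = -X (0, 0) (0, 1) := by linear_combination h4
    have e5 : X (1, 1) (0, 1) = -X (1, 0) (0, 0) := by rw [← hc, e3, map_neg, hc]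
    have e6 : X (1, 1) (1, 0) = -X (0, 1) (0, 0) := by rw [← hc, e4, map_neg, hc]
    intro i j
    fin_cases i <;> fin_cases j <;>
      simp [Y, mul_apply, magicMatrix, Fintype.sum_prod_type, hc, e1, e2, e3, e4, e5, e6] <;>
      ring
  let R : Matrix (Fin 4) (Fin 4) ℝ := Y.map Complex.re
  have hRY : R.map (fun r => (r : ℂ)) = Y := by
    ext i j
    exact Complex.conj_eq_iff_re.1 (hreal i j)
  have hRh : R.IsHermitian := by
    ext i j
    have := hY.isHermitian.apply i j
    simp only [R, conjTranspose_apply, map_apply, star_trivial]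
    rw [← this]; simp
  have hR : R.PosSemidef := by
    refine .of_dotProduct_mulVec_nonneg hRh fun x => ?_
    have := hY.dotProduct_mulVec_nonneg (fun k => (x k : ℂ))
    have e : star (fun k => (x k : ℂ)) ⬝ᵥ (Y *ᵥ fun k => (x k : ℂ)) =
        ((star x ⬝ᵥ (R *ᵥ x) : ℝ) : ℂ) := by
      rw [← hRY]
      simp [dotProduct, mulVec]
    rw [e] at this
    exact_mod_cast this
  let x : Fin 4 → Fin 4 → ℝ := fun i k => hRh.eigenvectorBasis i k
  have hinner : ∀ i j, x i ⬝ᵥ x j = if i = j then 1 else 0 := by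
    intro i j
    have := orthonormal_iff_ite.1 hRh.eigenvectorBasis.orthonormal i j
    rw [← this, EuclideanSpace.inner_eq_star_dotProduct, dotProduct_comm]
    rfl
  have hdec : R = ∑ i, hRh.eigenvalues i • vecMulVec (x i) (x i) := by
    conv_lhs => rw [hRh.spectral_theorem, Unitary.conjStarAlgAut_apply]
    ext i j
    simp only [mul_apply, diagonal_apply, Matrix.sum_apply, Matrix.smul_apply, vecMulVec_apply,
      smul_eq_mul, mul_ite, mul_zero, Finset.sum_ite_eq', Finset.mem_univ, if_true, star_apply,
      IsHermitian.eigenvectorUnitary_apply, Function.comp_apply, star_trivial, x]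
    refine Finset.sum_congr rfl fun k _ => ?_
    simp
    ring
  have hdecY : Y = ∑ i, hRh.eigenvalues i •
      vecMulVec (fun k => (x i k : ℂ)) (star fun k => (x i k : ℂ)) := by
    rw [← hRY, congrArg (fun M : Matrix (Fin 4) (Fin 4) ℝ => M.map fun r => (r : ℂ)) hdec]
    ext k l
    simp [Matrix.sum_apply, vecMulVec_apply]
  -- Passing to magic coordinates and back multiplies by 2 on each side, hence the division by 4.
  refine ⟨fun i => hRh.eigenvalues i / 4, x, fun i => ?_, fun i => by simp [hinner],
    fun i j hij => by simp [hinner, hij], ?_⟩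
  · have := hR.eigenvalues_nonneg i
    positivity
  · have e1 : (4 : ℂ) • X = magicMatrix * Y * magicMatrixᴴ := by
      have : magicMatrix * Y * magicMatrixᴴ =
          (magicMatrix * magicMatrixᴴ) * X * (magicMatrix * magicMatrixᴴ) := by
        simp only [Y, Matrix.mul_assoc]
      rw [this, magicMatrix_mul_conjTranspose]
      simp [smul_smul]
      norm_num
    have e2 : magicMatrix * Y * magicMatrixᴴ =
        ∑ i, hRh.eigenvalues i • magicState fun k => (x i k : ℂ) := by
      rw [hdecY]
      simp only [Matrix.mul_sum, Matrix.sum_mul, Matrix.mul_smul, Matrix.smul_mul, magicState,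
        star_mulVec, mul_vecMulVec, vecMulVec_mul]
    have e3 : X = (1 / 4 : ℝ) • ((4 : ℂ) • X) := by
      ext p q; simp
    rw [e3, e1, e2, Finset.smul_sum]
    refine Finset.sum_congr rfl fun i _ => ?_
    rw [smul_smul]
    congr 1
    ring

/-- A state on `ℂ² ⊗ ℂ²` with scalar marginals and positive partial transpose is separable. -/
lemma mem_separableCone_of_marginals {X : Matrix (Fin 2 × Fin 2) (Fin 2 × Fin 2) ℂ}
    (hX : X ∈ pptCone (Fin 2))
    (h1 : X (0, 0) (0, 0) + X (0, 1) (0, 1) = X (1, 0) (1, 0) + X (1, 1) (1, 1))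
    (h2 : X (0, 0) (1, 0) + X (0, 1) (1, 1) = 0)
    (h3 : X (0, 0) (0, 0) + X (1, 0) (1, 0) = X (0, 1) (0, 1) + X (1, 1) (1, 1))
    (h4 : X (0, 0) (0, 1) + X (1, 0) (1, 1) = 0) : X ∈ separableCone (Fin 2) := by
  obtain ⟨p, x, hp, hx1, hx0, rfl⟩ := exists_magic_decomposition hX.1 h1 h2 h3 h4
  refine sum_smul_mem_of_pairs (fun _ hx _ hy => separableCone_add_mem hx hy)
    (fun _ hx _ hc => separableCone_smul_mem hx hc) _
    (fun i j hij => magicState_add_mem_separableCone (hx0 i j hij) (by rw [hx1, hx1])) p hp ?_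
  intro k
  -- Testing on the witness of `x k` gives 2 Σ p_i − 4 p_k ≥ 0.
  have hk := (Complex.le_def.1 (hX.2.dotProduct_mulVec_nonneg (magicWitness (x k)))).1
  have e : partialTransposeMatrix (Fin 2) (∑ i, p i • magicState fun k => (x i k : ℂ)) =
      ∑ i, p i • partialTransposeMatrix (Fin 2) (magicState fun k => (x i k : ℂ)) := by
    rw [map_sum]; rfl
  rw [e, sum_mulVec, dotProduct_sum, Complex.re_sum] at hk
  simp only [smul_mulVec, dotProduct_smul, Complex.smul_re, magicWitness_quadraticForm, hx1] at hk
  have hs : ∀ i, p i • (2 * 1 * 1 - 4 * (x k ⬝ᵥ x i) ^ 2 : ℝ) =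
      2 * p i - if i = k then 4 * p k else 0 := by
    intro i
    split_ifs with h
    · subst h; rw [hx1, smul_eq_mul]; ring
    · rw [hx0 k i (Ne.symm h), smul_eq_mul]; ring
  simp only [hs, Finset.sum_sub_distrib, Finset.sum_ite_eq', Finset.mem_univ, if_true,
    ← Finset.mul_sum, Complex.zero_re] at hk
  linarith

/-- The trace after a filter on the first factor. -/
lemma trace_conj_kronecker_one (X : Matrix (Fin 2 × Fin 2) (Fin 2 × Fin 2) ℂ)
    (A : Matrix (Fin 2) (Fin 2) ℂ) :
    ((A ⊗ₖ (1 : Matrix (Fin 2) (Fin 2) ℂ)) * X * (A ⊗ₖ 1)ᴴ).trace =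
      (A * (X.submatrix (·, 0) (·, 0) + X.submatrix (·, 1) (·, 1)) * Aᴴ).trace := by
  simp only [trace, diag_apply, mul_apply, Fintype.sum_prod_type, conjTranspose_apply,
    Fin.sum_univ_two, kroneckerMap_apply, one_apply, Matrix.add_apply,
    submatrix_apply]
  simp
  ring

lemma trace_conj_one_kronecker (X : Matrix (Fin 2 × Fin 2) (Fin 2 × Fin 2) ℂ)
    (A : Matrix (Fin 2) (Fin 2) ℂ) :
    (((1 : Matrix (Fin 2) (Fin 2) ℂ) ⊗ₖ A) * X * (1 ⊗ₖ A)ᴴ).trace =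
      (A * (X.submatrix (0, ·) (0, ·) + X.submatrix (1, ·) (1, ·)) * Aᴴ).trace := by
  simp only [trace, diag_apply, mul_apply, Fintype.sum_prod_type, conjTranspose_apply,
    Fin.sum_univ_two, kroneckerMap_apply, one_apply, Matrix.add_apply,
    submatrix_apply]
  simp
  ring

/-- The optimal filter makes both marginals scalar, as is seen by varying one factor at a time.
Filters preserve both cones, and the inverse filter returns to `X`. -/
lemma mem_separableCone_of_posDef {X : Matrix (Fin 2 × Fin 2) (Fin 2 × Fin 2) ℂ}
    (hX : X ∈ pptCone (Fin 2)) (hd : X.PosDef) : X ∈ separableCone (Fin 2) := by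
  obtain ⟨A, B, hA, hB, hmin⟩ := exists_filter hd
  have hY := kronecker_conj_mem_pptCone hX A B
  generalize hYdef : (A ⊗ₖ B) * X * (A ⊗ₖ B)ᴴ = Y at hmin hY
  have m1 := scalar_of_trace_le (M := Y.submatrix (·, 0) (·, 0) + Y.submatrix (·, 1) (·, 1))
    ((hY.1.submatrix _).add (hY.1.submatrix _)) fun C => by
      have := hmin C 1
      rw [trace_conj_kronecker_one, det_one, norm_one, mul_one] at this
      convert this using 2
      simp [trace, Fintype.sum_prod_type]
  have m2 := scalar_of_trace_le (M := Y.submatrix (0, ·) (0, ·) + Y.submatrix (1, ·) (1, ·))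
    ((hY.1.submatrix _).add (hY.1.submatrix _)) fun C => by
      have := hmin 1 C
      rw [trace_conj_one_kronecker, det_one, norm_one, one_mul] at this
      convert this using 2
      simp [trace, Fintype.sum_prod_type]
      ring
  have hYs : Y ∈ separableCone (Fin 2) :=
    mem_separableCone_of_marginals hY m1.1 m1.2 m2.1 m2.2
  have hinv : X = (A⁻¹ ⊗ₖ B⁻¹) * Y * (A⁻¹ ⊗ₖ B⁻¹)ᴴ := by
    have h1 : (A⁻¹ ⊗ₖ B⁻¹) * (A ⊗ₖ B) = 1 := by
      rw [← mul_kronecker_mul, nonsing_inv_mul A hA, nonsing_inv_mul B hB, one_kronecker_one]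
    have h2 : (A⁻¹ ⊗ₖ B⁻¹) * ((A ⊗ₖ B) * X * (A ⊗ₖ B)ᴴ) * (A⁻¹ ⊗ₖ B⁻¹)ᴴ =
        ((A⁻¹ ⊗ₖ B⁻¹) * (A ⊗ₖ B)) * X * ((A⁻¹ ⊗ₖ B⁻¹) * (A ⊗ₖ B))ᴴ := by
      rw [conjTranspose_mul ((A⁻¹ ⊗ₖ B⁻¹)) ((A ⊗ₖ B))]
      simp only [Matrix.mul_assoc]
    rw [← hYdef, h2, h1]
    simp
  rw [hinv]
  exact kronecker_conj_mem_separableCone hYs _ _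

attribute [local instance] Matrix.normedAddCommGroup Matrix.normedSpace in
/-- For a pair of qubits, positivity of the partial transpose implies separability. -/
lemma pptCone_fin_two : pptCone (Fin 2) = separableCone (Fin 2) := by
  refine Set.Subset.antisymm (fun X hX => ?_) separableCone_subset_pptCone
  -- Adding a small multiple of the identity, which the partial transpose fixes, reduces to the
  -- positive definite case; closedness gives the limit.
  have hlim : Filter.Tendsto (fun n : ℕ => X + (1 / ((n : ℝ) + 1)) • (1 : Matrix _ _ ℂ))
      Filter.atTop (nhds X) := by
    have := (tendsto_one_div_add_atTop_nhds_zero_nat (𝕜 := ℝ)).smul_const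
      (1 : Matrix (Fin 2 × Fin 2) (Fin 2 × Fin 2) ℂ)
    simpa using this.const_add X
  refine isClosed_separableCone.mem_of_tendsto hlim (Filter.Eventually.of_forall fun n => ?_)
  have hpos : (0 : ℝ) < 1 / ((n : ℝ) + 1) := by positivity
  have h1 : ((1 / ((n : ℝ) + 1)) • (1 : Matrix (Fin 2 × Fin 2) (Fin 2 × Fin 2) ℂ)).PosDef :=
    PosDef.one.smul hpos
  refine mem_separableCone_of_posDef ⟨(h1.posSemidef_add hX.1).posSemidef, ?_⟩
    (h1.posSemidef_add hX.1)
  have e : partialTransposeMatrix (Fin 2) (X + (1 / ((n : ℝ) + 1)) • (1 : Matrix _ _ ℂ)) =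
      partialTransposeMatrix (Fin 2) X + (1 / ((n : ℝ) + 1)) • (1 : Matrix _ _ ℂ) := by
    rw [map_add]
    congr 1
    ext p q
    obtain ⟨i, j⟩ := p
    obtain ⟨k, l⟩ := q
    simp only [partialTransposeMatrix_apply, Matrix.smul_apply, one_apply, Prod.mk.injEq]
    congr 2
    simp [eq_comm]
  rw [e]
  exact hX.2.add h1.posSemidef

/-- A vector of `ℂ² ⊗ ℂ²` whose projection has positive partial transpose is a product vector. -/
lemma exists_eq_mul_of_partialTranspose_posSemidef {w : Fin 2 × Fin 2 → ℂ}
    (hw : (partialTransposeMatrix (Fin 2) (vecMulVec w (star w))).PosSemidef) :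
    ∃ f g : Fin 2 → ℂ, ∀ p, w p = f p.1 * g p.2 := by
  apply exists_eq_mul_of_det_eq_zero
  let d := w (0, 0) * w (1, 1) - w (0, 1) * w (1, 0)
  -- With `w` read as a matrix W, `v` is WJ for the quarter turn J. Then W Jᵀ Wᵀ = det(W) Jᵀ is
  -- antisymmetric, so the form equals −2|det W|².
  let v : Fin 2 × Fin 2 → ℂ := fun p => ![![w (0, 1), -w (0, 0)], ![w (1, 1), -w (1, 0)]] p.1 p.2
  have h := hw.dotProduct_mulVec_nonneg v
  have h' : star v ⬝ᵥ (partialTransposeMatrix (Fin 2) (vecMulVec w (star w)) *ᵥ v) =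
      -2 * (d * star d) := by
    rw [dotProduct_partialTransposeMatrix_vecMulVec]
    simp [Fin.sum_univ_two, v, d]
    ring
  rw [h', Complex.star_def, Complex.mul_conj] at h
  have h2 : 0 ≤ -2 * Complex.normSq d := by exact_mod_cast h
  have h3 : Complex.normSq d = 0 := le_antisymm (by linarith) (Complex.normSq_nonneg d)
  exact sub_eq_zero.1 (Complex.normSq_eq_zero.1 h3)

end Magic

/-! ### Choi's matrix is PPT but not separable. -/

section Choi

lemma choiMatrix_apply (i j k l : Fin 3) : choiMatrix (i, j) (k, l) =
    if i = j ∧ k = l then 1 else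
    if i = k ∧ j = l then (if j = i + 1 then 2 else 1 / 2) else
    if i = l ∧ j = k then 1 else 0 := by
  fin_cases i <;> fin_cases j <;> fin_cases k <;> fin_cases l <;>
    simp [choiMatrix, finProdFinEquiv]

lemma partialTransposeMatrix_choiMatrix :
    partialTransposeMatrix (Fin 3) choiMatrix = choiMatrix := by
  ext ⟨i, j⟩ ⟨k, l⟩
  simp only [partialTransposeMatrix_apply, choiMatrix_apply]
  fin_cases i <;> fin_cases j <;> fin_cases k <;> fin_cases l <;> simp

/-- The vectors `2 e_i ⊗ e_{i+1} + e_{i+1} ⊗ e_i`. -/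
def choiVec (r i j : Fin 3) : ℂ :=
  if i = r ∧ j = r + 1 then 2 else if i = r + 1 ∧ j = r then 1 else 0

/-- This shows positivity; as the partial transpose fixes the matrix, membership in `pptCone`
follows. -/
lemma choiMatrix_eq_sum : choiMatrix =
    vecMulVec (fun p => if p.1 = p.2 then 1 else 0) (star fun p => if p.1 = p.2 then 1 else 0) +
      ∑ r, (1 / 2 : ℝ) • vecMulVec (fun p => choiVec r p.1 p.2)
        (star fun p => choiVec r p.1 p.2) := by
  ext ⟨i, j⟩ ⟨k, l⟩
  simp only [choiMatrix_apply, Fin.sum_univ_three, vecMulVec_apply, Matrix.add_apply,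
    Matrix.smul_apply, Pi.star_apply, choiVec]
  fin_cases i <;> fin_cases j <;> fin_cases k <;> fin_cases l <;> simp

lemma choiMatrix_mem_pptCone : choiMatrix ∈ pptCone (Fin 3) := by
  have : choiMatrix.PosSemidef := by
    rw [choiMatrix_eq_sum]
    exact (posSemidef_vecMulVec_self_star _).add (posSemidef_sum _ fun r _ =>
      posSemidef_real_smul (posSemidef_vecMulVec_self_star _) (by norm_num))
  exact ⟨this, by rwa [partialTransposeMatrix_choiMatrix]⟩

/-- A product vector in the range of Choi's matrix vanishes. -/
lemma mul_eq_zero_of_mem_range {f g : Fin 3 → ℂ} (h01 : f 0 * g 0 = f 1 * g 1)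
    (h12 : f 1 * g 1 = f 2 * g 2) (a : f 0 * g 1 = 2 * (f 1 * g 0))
    (b : f 1 * g 2 = 2 * (f 2 * g 1)) (c : f 2 * g 0 = 2 * (f 0 * g 2)) :
    ∀ i j, f i * g j = 0 := by
  obtain ⟨t, ht⟩ : ∃ t, t = f 0 * g 0 := ⟨_, rfl⟩
  have ht0 : t = 0 := by
    -- Multiplying the three cyclic relations compares the same six factors, grouped in two ways.
    have h : t ^ 3 = 8 * t ^ 3 := by
      calc t ^ 3 = (f 0 * g 0) * (f 1 * g 1) * (f 2 * g 2) := by rw [← h12, ← h01, ← ht]; ring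
        _ = (f 0 * g 1) * (f 1 * g 2) * (f 2 * g 0) := by ring
        _ = 8 * ((f 0 * g 0) * (f 1 * g 1) * (f 2 * g 2)) := by rw [a, b, c]; ring
        _ = 8 * t ^ 3 := by rw [← h12, ← h01, ← ht]; ring
    have : t ^ 3 = 0 := by linear_combination -h / 7
    exact pow_eq_zero_iff (by norm_num) |>.1 this
  have e0 : f 0 * g 0 = 0 := by rw [← ht, ht0]
  have e1 : f 1 * g 1 = 0 := by rw [← h01, e0]
  have e2 : f 2 * g 2 = 0 := by rw [← h12, e1]
  have a' : f 1 * g 0 = 0 := by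
    -- The product of `f 0 * g 1` and `f 1 * g 0` regroups into diagonal products, which vanish.
    have : (f 1 * g 0) ^ 2 = 0 := by linear_combination (-(f 1 * g 0) * a + (f 1 * g 1) * e0) / 2
    exact pow_eq_zero_iff (by norm_num) |>.1 this
  have b' : f 2 * g 1 = 0 := by
    have : (f 2 * g 1) ^ 2 = 0 := by linear_combination (-(f 2 * g 1) * b + (f 2 * g 2) * e1) / 2
    exact pow_eq_zero_iff (by norm_num) |>.1 this
  have c' : f 0 * g 2 = 0 := by
    have : (f 0 * g 2) ^ 2 = 0 := by linear_combination (-(f 0 * g 2) * c + (f 0 * g 0) * e2) / 2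
    exact pow_eq_zero_iff (by norm_num) |>.1 this
  have a'' : f 0 * g 1 = 0 := by rw [a, a', mul_zero]
  have b'' : f 1 * g 2 = 0 := by rw [b, b', mul_zero]
  have c'' : f 2 * g 0 = 0 := by rw [c, c', mul_zero]
  intro i j
  fin_cases i <;> fin_cases j <;> assumption

lemma separableCone_exists_vec {ι : Type*} [Fintype ι] {X : Matrix (ι × ι) (ι × ι) ℂ}
    (hX : X ∈ separableCone ι) : ∃ (κ : Type) (_ : Fintype κ) (f g : κ → ι → ℂ),
      X = ∑ r, vecMulVec (fun p => f r p.1 * g r p.2) (star fun p => f r p.1 * g r p.2) := by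
  obtain ⟨m, A, B, hA, hB, rfl⟩ := hX
  choose a f hf using fun i => posSemidef_iff_eq_sum_vecMulVec.1 (hA i)
  choose b g hg using fun i => posSemidef_iff_eq_sum_vecMulVec.1 (hB i)
  refine ⟨Σ i, Fin (a i) × Fin (b i), inferInstance, fun r => f r.1 r.2.1, fun r => g r.1 r.2.2, ?_⟩
  rw [Fintype.sum_sigma]
  refine Finset.sum_congr rfl fun i _ => ?_
  ext p q
  rw [Fintype.sum_prod_type, hf i, hg i]
  simp only [kroneckerMap_apply, Matrix.sum_apply, vecMulVec_apply, Finset.sum_mul_sum,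
    Pi.star_apply, star_mul']
  exact Finset.sum_congr rfl fun k _ => Finset.sum_congr rfl fun l _ => by ring

/-- Product vectors in a separable decomposition are orthogonal to the kernel. -/
lemma dotProduct_eq_zero_of_mulVec_eq_zero {κ ρ : Type*} [Fintype κ] [Fintype ρ] {X : Matrix κ κ ℂ}
    {w : ρ → κ → ℂ} (hX : X = ∑ r, vecMulVec (w r) (star (w r)))
    {v : κ → ℂ} (hv : X *ᵥ v = 0) (r : ρ) : star v ⬝ᵥ w r = 0 := by
  replace hv : star v ⬝ᵥ (X *ᵥ v) = 0 := by rw [hv, dotProduct_zero]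
  rw [hX] at hv
  have h : ∀ r, star v ⬝ᵥ (vecMulVec (w r) (star (w r)) *ᵥ v) =
      (Complex.normSq (star v ⬝ᵥ w r) : ℂ) := by
    intro r
    rw [vecMulVec_mulVec, ← Complex.mul_conj, ← Complex.star_def, dotProduct_smul,
      ← star_dotProduct, MulOpposite.smul_eq_mul_unop, MulOpposite.unop_op]
  rw [sum_mulVec, dotProduct_sum] at hv
  simp only [h] at hv
  have hv' : ∑ r, Complex.normSq (star v ⬝ᵥ w r) = 0 := by exact_mod_cast hv
  rw [Finset.sum_eq_zero_iff_of_nonneg fun _ _ => Complex.normSq_nonneg _] at hv'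
  exact Complex.normSq_eq_zero.1 (hv' r (Finset.mem_univ r))

/-- Choi's matrix is not separable. -/
lemma choiMatrix_notMem_separableCone : choiMatrix ∉ separableCone (Fin 3) := by
  intro hX
  obtain ⟨κ, _, f, g, h⟩ := separableCone_exists_vec hX
  have ker : ∀ V : Matrix (Fin 3) (Fin 3) ℂ, choiMatrix *ᵥ (fun p => V p.1 p.2) = 0 → ∀ r,
      ∑ i, ∑ j, star (V i j) * (f r i * g r j) = 0 := by
    intro V hv r
    have := dotProduct_eq_zero_of_mulVec_eq_zero h hv r
    rwa [dotProduct, Fintype.sum_prod_type] at this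
  -- The five vectors `k1` to `k5` span the kernel: two differences of diagonal basis vectors, and
  -- for each `choiVec` the vector orthogonal to it on its support.
  have k1 := ker !![1, 0, 0; 0, -1, 0; 0, 0, 0] (by
    ext ⟨i, j⟩
    simp only [mulVec, dotProduct, Fintype.sum_prod_type, Fin.sum_univ_three, choiMatrix_apply]
    fin_cases i <;> fin_cases j <;> simp)
  have k2 := ker !![0, 0, 0; 0, 1, 0; 0, 0, -1] (by
    ext ⟨i, j⟩
    simp only [mulVec, dotProduct, Fintype.sum_prod_type, Fin.sum_univ_three, choiMatrix_apply]
    fin_cases i <;> fin_cases j <;> simp)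
  have k3 := ker !![0, 1, 0; -2, 0, 0; 0, 0, 0] (by
    ext ⟨i, j⟩
    simp only [mulVec, dotProduct, Fintype.sum_prod_type, Fin.sum_univ_three, choiMatrix_apply]
    fin_cases i <;> fin_cases j <;> simp)
  have k4 := ker !![0, 0, 0; 0, 0, 1; 0, -2, 0] (by
    ext ⟨i, j⟩
    simp only [mulVec, dotProduct, Fintype.sum_prod_type, Fin.sum_univ_three, choiMatrix_apply]
    fin_cases i <;> fin_cases j <;> simp)
  have k5 := ker !![0, 0, -2; 0, 0, 0; 1, 0, 0] (by
    ext ⟨i, j⟩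
    simp only [mulVec, dotProduct, Fintype.sum_prod_type, Fin.sum_univ_three, choiMatrix_apply]
    fin_cases i <;> fin_cases j <;> simp)
  have hz : ∀ r i j, f r i * g r j = 0 := by
    intro r
    have l1 := k1 r
    have l2 := k2 r
    have l3 := k3 r
    have l4 := k4 r
    have l5 := k5 r
    simp [Fin.sum_univ_three, map_ofNat] at l1 l2 l3 l4 l5
    apply mul_eq_zero_of_mem_range
    · linear_combination l1
    · linear_combination l2
    · linear_combination l3
    · linear_combination l4
    · linear_combination l5
  have h0 : choiMatrix (0, 0) (0, 0) = 0 := by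
    rw [h, Matrix.sum_apply]
    simp [vecMulVec_apply, hz]
  rw [choiMatrix_apply] at h0
  simp at h0

end Choi

/-! ### Operators as matrices in an orthonormal basis. -/

section Coordinates

variable {E : Type*} [NormedAddCommGroup E] [InnerProductSpace ℂ E] [FiniteDimensional ℂ E]
  {κ : Type*} [Fintype κ] [DecidableEq κ]

/-- The matrix of an operator in an orthonormal basis. -/
def operatorMatrix (b : OrthonormalBasis κ ℂ E) : (E →L[ℂ] E) ≃ₗ[ℂ] Matrix κ κ ℂ :=
  LinearMap.toContinuousLinearMap.symm ≪≫ₗ LinearMap.toMatrix b.toBasis b.toBasis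

lemma operatorMatrix_apply (b : OrthonormalBasis κ ℂ E) (a : E →L[ℂ] E) (i j : κ) :
    operatorMatrix b a i j = inner ℂ (b i) (a (b j)) := by
  simp [operatorMatrix, LinearMap.toMatrix_apply, OrthonormalBasis.repr_apply_apply]

lemma operatorMatrix_posSemidef_iff (b : OrthonormalBasis κ ℂ E) {a : E →L[ℂ] E} :
    (operatorMatrix b a).PosSemidef ↔ 0 ≤ a := by
  rw [ContinuousLinearMap.nonneg_iff_isPositive, ← ContinuousLinearMap.isPositive_toLinearMap_iff]
  exact LinearMap.posSemidef_toMatrix_iff b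

lemma operatorMatrix_mul (b : OrthonormalBasis κ ℂ E) (a c : E →L[ℂ] E) :
    operatorMatrix b (a * c) = operatorMatrix b a * operatorMatrix b c :=
  LinearMap.toMatrix_mul b.toBasis _ _

lemma operatorMatrix_star [CompleteSpace E] (b : OrthonormalBasis κ ℂ E) (a : E →L[ℂ] E) :
    operatorMatrix b (star a) = (operatorMatrix b a)ᴴ := by
  ext i j
  rw [conjTranspose_apply, operatorMatrix_apply, operatorMatrix_apply,
    ContinuousLinearMap.star_eq_adjoint, ContinuousLinearMap.adjoint_inner_right]
  exact (inner_conj_symm _ _).symm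

lemma operatorMatrix_star_mul_apply [CompleteSpace E] (b : OrthonormalBasis κ ℂ E)
    (a c : E →L[ℂ] E) (i j : κ) :
    operatorMatrix b (star a * c) i j = inner ℂ (a (b i)) (c (b j)) := by
  rw [operatorMatrix_apply, ContinuousLinearMap.star_eq_adjoint, mul_apply_eq_comp,
    ContinuousLinearMap.adjoint_inner_right]

lemma operatorMatrix_rankOne (b : OrthonormalBasis κ ℂ E) (x y : E) :
    operatorMatrix b (InnerProductSpace.rankOne ℂ x y) =
      vecMulVec (b.repr x) (star (b.repr y : κ → ℂ)) := by
  ext i j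
  rw [operatorMatrix_apply, InnerProductSpace.rankOne_apply, inner_smul_right, vecMulVec_apply,
    Pi.star_apply, b.repr_apply_apply, b.repr_apply_apply, ← inner_conj_symm y, mul_comm]
  rfl

lemma operatorMatrix_rankOne_basis (b : OrthonormalBasis κ ℂ E) (i j : κ) :
    operatorMatrix b (InnerProductSpace.rankOne ℂ (b i) (b j)) = single i j 1 := by
  ext k l
  rw [operatorMatrix_rankOne, vecMulVec_apply, b.repr_self, b.repr_self]
  simp [single_apply, Pi.single_apply]
  grind

end Coordinates

/-! ### Transfer of the cones to matrices. -/

section Bridge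

variable {H : Type*} [NormedAddCommGroup H] [InnerProductSpace ℂ H] [FiniteDimensional ℂ H]
  {n : ℕ} (b : OrthonormalBasis (Fin n) ℂ H)

/-- The matrix of an element of `B(H) ⊗ B(H)`. -/
def tensorMatrix : ((H →L[ℂ] H) ⊗[ℂ] (H →L[ℂ] H)) ≃ₗ[ℂ]
    Matrix (Fin n × Fin n) (Fin n × Fin n) ℂ :=
  toOperator H ≪≫ₗ operatorMatrix (b.tensorProduct b)

lemma toOperator_tmul_apply (x y : H →L[ℂ] H) (f g : H) :
    toOperator H (x ⊗ₜ y) (f ⊗ₜ g) = x f ⊗ₜ y g := by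
  simp [toOperator]

lemma tensorMatrix_tmul (x y : H →L[ℂ] H) :
    tensorMatrix b (x ⊗ₜ y) = operatorMatrix b x ⊗ₖ operatorMatrix b y := by
  ext p q
  rw [kroneckerMap_apply, tensorMatrix, LinearEquiv.trans_apply, operatorMatrix_apply,
    OrthonormalBasis.tensorProduct_apply', OrthonormalBasis.tensorProduct_apply',
    toOperator_tmul_apply, TensorProduct.inner_tmul, operatorMatrix_apply, operatorMatrix_apply]

lemma operatorMatrix_transposeMap (a : H →L[ℂ] H) :
    operatorMatrix b (transposeMap b a) = (operatorMatrix b a)ᵀ := by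
  simp [operatorMatrix, transposeMap]

set_option synthInstance.maxHeartbeats 200000 in
lemma tensorMatrix_partialTranspose (u : (H →L[ℂ] H) ⊗[ℂ] (H →L[ℂ] H)) :
    tensorMatrix b (partialTranspose b u) =
      partialTransposeMatrix (Fin n) (tensorMatrix b u) := by
  induction u with
  | zero => simp
  | add u v hu hv => simp only [map_add, hu, hv]
  | tmul x y =>
    rw [partialTranspose, LinearMap.lTensor_tmul, tensorMatrix_tmul, tensorMatrix_tmul,
      operatorMatrix_transposeMap, partialTransposeMatrix_kronecker]

lemma mem_positiveCone_iff (u : (H →L[ℂ] H) ⊗[ℂ] (H →L[ℂ] H)) :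
    u ∈ positiveCone H ↔ (tensorMatrix b u).PosSemidef :=
  (operatorMatrix_posSemidef_iff (b.tensorProduct b)).symm

lemma partialTranspose_partialTranspose (u : (H →L[ℂ] H) ⊗[ℂ] (H →L[ℂ] H)) :
    partialTranspose b (partialTranspose b u) = u := by
  apply (tensorMatrix b).injective
  simp [tensorMatrix_partialTranspose]

lemma mem_decomposableCone_iff (u : (H →L[ℂ] H) ⊗[ℂ] (H →L[ℂ] H)) :
    u ∈ decomposableCone b ↔ tensorMatrix b u ∈ pptCone (Fin n) := by
  refine and_congr (mem_positiveCone_iff b u) ?_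
  rw [← tensorMatrix_partialTranspose, ← mem_positiveCone_iff]
  constructor
  · rintro ⟨v, hv, rfl⟩
    rwa [partialTranspose_partialTranspose]
  · exact fun h => ⟨_, h, partialTranspose_partialTranspose b u⟩

set_option synthInstance.maxHeartbeats 200000 in
lemma mem_projectiveCone_iff (u : (H →L[ℂ] H) ⊗[ℂ] (H →L[ℂ] H)) :
    u ∈ projectiveCone H ↔ tensorMatrix b u ∈ separableCone (Fin n) := by
  constructor
  · rintro ⟨m, x, y, hx, hy, rfl⟩
    exact ⟨m, fun i => operatorMatrix b (x i), fun i => operatorMatrix b (y i),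
      fun i => (operatorMatrix_posSemidef_iff b).2 (hx i),
      fun i => (operatorMatrix_posSemidef_iff b).2 (hy i), by simp [tensorMatrix_tmul]⟩
  · rintro ⟨m, A, B, hA, hB, h⟩
    refine ⟨m, fun i => (operatorMatrix b).symm (A i), fun i => (operatorMatrix b).symm (B i),
      fun i => (operatorMatrix_posSemidef_iff b).1 (by simpa using hA i),
      fun i => (operatorMatrix_posSemidef_iff b).1 (by simpa using hB i), ?_⟩
    apply (tensorMatrix b).injective
    simp [h, tensorMatrix_tmul]

lemma decomposableCone_eq_iff :
    decomposableCone b = projectiveCone H ↔ pptCone (Fin n) = separableCone (Fin n) := by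
  simp only [Set.ext_iff, mem_decomposableCone_iff, mem_projectiveCone_iff b]
  exact ⟨fun h X => by simpa using h ((tensorMatrix b).symm X), fun h u => h _⟩

lemma projectiveCone_subset_decomposableCone : projectiveCone H ⊆ decomposableCone b := by
  intro u hu
  rw [mem_decomposableCone_iff]
  exact separableCone_subset_pptCone ((mem_projectiveCone_iff b u).1 hu)

lemma tensorMatrix_ketBra (h : H ⊗[ℂ] H) : tensorMatrix b (ketBra h) =
    vecMulVec ((b.tensorProduct b).repr h) (star ((b.tensorProduct b).repr h : _ → ℂ)) := by
  rw [tensorMatrix, LinearEquiv.trans_apply, ketBra, LinearEquiv.apply_symm_apply,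
    operatorMatrix_rankOne]

set_option synthInstance.maxHeartbeats 200000 in
lemma tensorMatrix_choiElement (b : OrthonormalBasis (Fin 3) ℂ H) :
    tensorMatrix b (choiElement b) = choiMatrix := by
  conv_rhs => rw [eq_sum_smul_kronecker choiMatrix]
  simp only [choiElement, map_sum, map_smul, tensorMatrix_tmul, operatorMatrix_rankOne_basis]

lemma ketBra_tmul (f g : H) : ketBra (f ⊗ₜ[ℂ] g) =
    InnerProductSpace.rankOne ℂ f f ⊗ₜ[ℂ] InnerProductSpace.rankOne ℂ g g := by
  let c := stdOrthonormalBasis ℂ H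
  apply (tensorMatrix c).injective
  rw [tensorMatrix_ketBra, tensorMatrix_tmul, operatorMatrix_rankOne, operatorMatrix_rankOne]
  ext p q
  simp only [vecMulVec_apply, kroneckerMap_apply, Pi.star_apply,
    OrthonormalBasis.tensorProduct_repr_tmul_apply', star_mul']
  ring

lemma exists_eq_tmul_of_partialTranspose_ketBra (b : OrthonormalBasis (Fin 2) ℂ H) {h : H ⊗[ℂ] H}
    (hh : partialTranspose b (ketBra h) ∈ positiveCone H) : ∃ f g : H, h = f ⊗ₜ[ℂ] g := by
  rw [mem_positiveCone_iff b, tensorMatrix_partialTranspose, tensorMatrix_ketBra] at hh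
  obtain ⟨f, g, hfg⟩ := exists_eq_mul_of_partialTranspose_posSemidef hh
  refine ⟨b.repr.symm (WithLp.toLp 2 f), b.repr.symm (WithLp.toLp 2 g), ?_⟩
  apply (b.tensorProduct b).repr.injective
  ext p
  rw [OrthonormalBasis.tensorProduct_repr_tmul_apply', hfg p]
  simp [mul_comm]

/-! ### Choi matrices of maps and complete positivity. -/

/-- The Choi matrix of a linear map of `B(H)`. -/
def mapMatrix (T : (H →L[ℂ] H) →ₗ[ℂ] (H →L[ℂ] H)) : Matrix (Fin n × Fin n) (Fin n × Fin n) ℂ :=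
  of fun p q => operatorMatrix b (T (InnerProductSpace.rankOne ℂ (b p.1) (b q.1))) p.2 q.2

lemma operatorMatrix_map_apply (T : (H →L[ℂ] H) →ₗ[ℂ] (H →L[ℂ] H)) (a : H →L[ℂ] H) (k l : Fin n) :
    operatorMatrix b (T a) k l =
      ∑ i, ∑ j, operatorMatrix b a i j * mapMatrix b T (i, k) (j, l) := by
  have ha : a = ∑ i, ∑ j, operatorMatrix b a i j • InnerProductSpace.rankOne ℂ (b i) (b j) := by
    apply (operatorMatrix b).injective
    simp only [map_sum, map_smul, operatorMatrix_rankOne_basis]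
    conv_lhs => rw [matrix_eq_sum_single (operatorMatrix b a)]
    simp
  conv_lhs => rw [ha]
  simp only [map_sum, map_smul, Matrix.sum_apply, Matrix.smul_apply, smul_eq_mul]
  rfl

lemma mapMatrix_injective : Function.Injective (mapMatrix b) := by
  intro T S h
  ext1 a
  apply (operatorMatrix b).injective
  ext k l
  rw [operatorMatrix_map_apply, operatorMatrix_map_apply, h]

lemma mapMatrix_surjective : Function.Surjective (mapMatrix b) := by
  intro C
  let T : (H →L[ℂ] H) →ₗ[ℂ] (H →L[ℂ] H) :=
    { toFun := fun a => (operatorMatrix b).symm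
        (of fun k l => ∑ i, ∑ j, operatorMatrix b a i j * C (i, k) (j, l))
      map_add' := fun x y => by
        rw [← map_add]
        congr 1
        ext k l
        simp [add_mul, Finset.sum_add_distrib]
      map_smul' := fun c x => by
        rw [← map_smul]
        congr 1
        ext k l
        simp [Finset.mul_sum, mul_assoc] }
  refine ⟨T, ?_⟩
  ext p q
  simp only [mapMatrix, T, of_apply, LinearMap.coe_mk, AddHom.coe_mk, LinearEquiv.apply_symm_apply,
    operatorMatrix_rankOne_basis, single_apply]
  simp [ite_and]

lemma mapMatrix_add (T S : (H →L[ℂ] H) →ₗ[ℂ] (H →L[ℂ] H)) :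
    mapMatrix b (T + S) = mapMatrix b T + mapMatrix b S := by
  ext p q
  simp [mapMatrix]

lemma mapMatrix_transposeMap_comp (T : (H →L[ℂ] H) →ₗ[ℂ] (H →L[ℂ] H)) :
    mapMatrix b (transposeMap b ∘ₗ T) = partialTransposeMatrix (Fin n) (mapMatrix b T) := by
  ext p q
  simp [mapMatrix, operatorMatrix_transposeMap]

/-- This identity translates positivity of `T` into nonnegativity of its Choi matrix on the
separable cone. -/
lemma pairing_mapMatrix_kronecker (T : (H →L[ℂ] H) →ₗ[ℂ] (H →L[ℂ] H)) (a : H →L[ℂ] H)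
    (B : Matrix (Fin n) (Fin n) ℂ) :
    pairing (mapMatrix b T) (operatorMatrix b a ⊗ₖ B) = pairing (operatorMatrix b (T a)) B := by
  simp only [pairing, operatorMatrix_map_apply, Fintype.sum_prod_type, kroneckerMap_apply,
    Finset.sum_mul]
  rw [Finset.sum_comm]
  refine Finset.sum_congr rfl fun k _ => ?_
  conv_lhs => enter [2, i]; rw [Finset.sum_comm]
  rw [Finset.sum_comm]
  refine Finset.sum_congr rfl fun l _ => Finset.sum_congr rfl fun i _ =>
    Finset.sum_congr rfl fun j _ => by ring

/-- A map with positive Choi matrix is a sum of maps `a ↦ K a K*`. -/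
lemma exists_kraus [CompleteSpace H] {T : (H →L[ℂ] H) →ₗ[ℂ] (H →L[ℂ] H)}
    (hT : (mapMatrix b T).PosSemidef) :
    ∃ (m : ℕ) (K : Fin m → (H →L[ℂ] H)), ∀ a, T a = ∑ r, K r * a * star (K r) := by
  obtain ⟨m, v, hv⟩ := posSemidef_iff_eq_sum_vecMulVec.1 hT
  -- The vectors of a rank-one decomposition of the Choi matrix, reshaped into square matrices, are
  -- the Kraus operators.
  refine ⟨m, fun r => (operatorMatrix b).symm (of fun k i => v r (i, k)), fun a => ?_⟩
  apply (operatorMatrix b).injective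
  ext k l
  rw [operatorMatrix_map_apply, hv]
  simp only [map_sum, operatorMatrix_mul, operatorMatrix_star, LinearEquiv.apply_symm_apply,
    Matrix.sum_apply, mul_apply, conjTranspose_apply, of_apply, vecMulVec_apply, Pi.star_apply,
    Finset.mul_sum, Finset.sum_mul]
  conv_lhs => enter [2, i]; rw [Finset.sum_comm]
  rw [Finset.sum_comm]
  refine Finset.sum_congr rfl fun r _ => ?_
  rw [Finset.sum_comm]
  exact Finset.sum_congr rfl fun j _ => Finset.sum_congr rfl fun i _ => by ring

lemma _root_.CStarMatrix.finsetSum_apply {ρ m k A : Type*} [AddCommMonoid A] (s : Finset ρ)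
    (f : ρ → CStarMatrix m k A) (i : m) (j : k) : (∑ r ∈ s, f r) i j = ∑ r ∈ s, f r i j := by
  classical
  induction s using Finset.induction_on with
  | empty => rfl
  | insert a s ha ih => rw [Finset.sum_insert ha, Finset.sum_insert ha, CStarMatrix.add_apply, ih]

/-- Each amplification of a ↦ K a K* is conjugation by the diagonal matrix with entries K. -/
lemma isCompletelyPositive_of_posSemidef {T : (H →L[ℂ] H) →ₗ[ℂ] (H →L[ℂ] H)}
    (hT : (mapMatrix b T).PosSemidef) : IsCompletelyPositive T := by
  have : CompleteSpace H := FiniteDimensional.complete ℂ H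
  obtain ⟨m, K, hK⟩ := exists_kraus b hT
  refine ⟨{ T with map_cstarMatrix_nonneg' := fun k M hM => ?_ }, rfl⟩
  let D : Fin m → CStarMatrix (Fin k) (Fin k) (H →L[ℂ] H) := fun r =>
    CStarMatrix.ofMatrix (diagonal fun _ => K r)
  have : M.map T = ∑ r, D r * M * star (D r) := by
    ext1 i j
    rw [CStarMatrix.map_apply, hK, CStarMatrix.finsetSum_apply]
    refine Finset.sum_congr rfl fun r _ => ?_
    simp [D, CStarMatrix.mul_apply, CStarMatrix.star_apply, diagonal_apply, apply_ite star]
  change 0 ≤ M.map T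
  rw [this]
  exact Finset.sum_nonneg fun r _ => star_right_conjugate_nonneg hM _

/-- Positive elements are generated by the L*L, whose flattened matrices are sums of Gram matrices
of the vectors `L k i (b j)`. -/
lemma posSemidef_of_cstarMatrix_nonneg [CompleteSpace H]
    {M : CStarMatrix (Fin n) (Fin n) (H →L[ℂ] H)} (hM : 0 ≤ M) :
    (of fun p q : Fin n × Fin n => operatorMatrix b (M p.1 q.1) p.2 q.2).PosSemidef := by
  rw [StarOrderedRing.nonneg_iff] at hM
  induction hM using AddSubmonoid.closure_induction with
  | mem x hx =>
    obtain ⟨L, rfl⟩ := hx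
    have key : (of fun p q : Fin n × Fin n => operatorMatrix b ((star L * L) p.1 q.1) p.2 q.2) =
        ∑ k, gram ℂ fun p : Fin n × Fin n => L k p.1 (b p.2) := by
      ext p q
      rw [of_apply, CStarMatrix.mul_apply, map_sum, Matrix.sum_apply, Matrix.sum_apply]
      refine Finset.sum_congr rfl fun k _ => ?_
      rw [gram_apply, CStarMatrix.star_apply, operatorMatrix_star_mul_apply]
    rw [key]
    exact posSemidef_sum _ fun k _ => posSemidef_gram _ _
  | zero =>
    have key : (of fun p q : Fin n × Fin n => operatorMatrix b
        ((0 : CStarMatrix (Fin n) (Fin n) (H →L[ℂ] H)) p.1 q.1) p.2 q.2) = 0 := by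
      ext p q
      rw [of_apply, CStarMatrix.zero_apply, LinearEquiv.map_zero]
      rfl
    rw [key]
    exact PosSemidef.zero
  | add x y _ _ hx hy =>
    have key : (of fun p q : Fin n × Fin n => operatorMatrix b ((x + y) p.1 q.1) p.2 q.2) =
        (of fun p q : Fin n × Fin n => operatorMatrix b (x p.1 q.1) p.2 q.2) +
          of fun p q : Fin n × Fin n => operatorMatrix b (y p.1 q.1) p.2 q.2 := by
      ext p q
      rw [of_apply, CStarMatrix.add_apply, LinearEquiv.map_add]
      rfl
    rw [key]
    exact hx.add hy

lemma posSemidef_of_isCompletelyPositive {T : (H →L[ℂ] H) →ₗ[ℂ] (H →L[ℂ] H)}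
    (hT : IsCompletelyPositive T) : (mapMatrix b T).PosSemidef := by
  have : CompleteSpace H := FiniteDimensional.complete ℂ H
  obtain ⟨φ, rfl⟩ := hT
  rcases isEmpty_or_nonempty (Fin n) with hn | ⟨⟨e⟩⟩
  · rw [show mapMatrix b φ.toLinearMap = 0 from Subsingleton.elim _ _]
    exact PosSemidef.zero
  -- The matrix of all matrix units is N*N, where N has a single nonzero row, at an arbitrary index
  -- `e`. Applying the map entrywise yields the Choi matrix.
  let N : CStarMatrix (Fin n) (Fin n) (H →L[ℂ] H) := CStarMatrix.ofMatrix
    (of fun i j => if i = e then InnerProductSpace.rankOne ℂ (b e) (b j) else 0)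
  have hM : ∀ i j, (star N * N) i j = InnerProductSpace.rankOne ℂ (b i) (b j) := by
    intro i j
    rw [CStarMatrix.mul_apply, Finset.sum_eq_single e]
    · simp only [N, CStarMatrix.star_apply, CStarMatrix.ofMatrix_apply, of_apply, if_true]
      apply (operatorMatrix b).injective
      rw [operatorMatrix_mul, operatorMatrix_star, operatorMatrix_rankOne_basis,
        operatorMatrix_rankOne_basis, operatorMatrix_rankOne_basis]
      simp
    · intro k _ hk
      simp [N, hk]
    · simp
  have h := posSemidef_of_cstarMatrix_nonneg b
    (φ.map_cstarMatrix_nonneg' n (star N * N) (star_mul_self_nonneg N))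
  convert h using 1
  ext p q
  rw [mapMatrix, of_apply, of_apply, CStarMatrix.map_apply, hM]

lemma isCompletelyPositive_iff {T : (H →L[ℂ] H) →ₗ[ℂ] (H →L[ℂ] H)} :
    IsCompletelyPositive T ↔ (mapMatrix b T).PosSemidef :=
  ⟨posSemidef_of_isCompletelyPositive b, isCompletelyPositive_of_posSemidef b⟩

lemma isDecomposable_iff {T : (H →L[ℂ] H) →ₗ[ℂ] (H →L[ℂ] H)} :
    IsDecomposable b T ↔ mapMatrix b T ∈ pptDualCone (Fin n) := by
  constructor
  · rintro ⟨T₁, T₂, h₁, h₂, rfl⟩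
    rw [IsCopositive, isCompletelyPositive_iff b, mapMatrix_transposeMap_comp] at h₂
    exact ⟨_, _, (isCompletelyPositive_iff b).1 h₁, h₂, by simp [mapMatrix_add]⟩
  · rintro ⟨P, Q, hP, hQ, h⟩
    obtain ⟨T₁, rfl⟩ := mapMatrix_surjective b P
    obtain ⟨T₂, h₂⟩ := mapMatrix_surjective b (partialTransposeMatrix (Fin n) Q)
    refine ⟨T₁, T₂, (isCompletelyPositive_iff b).2 hP, ?_, mapMatrix_injective b ?_⟩
    · rw [IsCopositive, isCompletelyPositive_iff b, mapMatrix_transposeMap_comp, h₂]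
      simpa using hQ
    · rw [h, mapMatrix_add, h₂]

/-! ### Duality between cones and maps. -/

lemma IsPositiveMap.map_star {V : Type*} [NormedAddCommGroup V] [InnerProductSpace ℂ V]
    [CompleteSpace V] {T : (V →L[ℂ] V) →ₗ[ℂ] (V →L[ℂ] V)}
    (hT : IsPositiveMap T) (a : V →L[ℂ] V) : T (star a) = star (T a) := by
  let f : (V →L[ℂ] V) →ₚ[ℂ] (V →L[ℂ] V) := PositiveLinearMap.mk₀ T hT
  exact StarHomClass.map_star f a

lemma IsPositiveMap.mapMatrix_isHermitian {T : (H →L[ℂ] H) →ₗ[ℂ] (H →L[ℂ] H)}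
    (hT : IsPositiveMap T) : (mapMatrix b T).IsHermitian := by
  have : CompleteSpace H := FiniteDimensional.complete ℂ H
  ext p q
  have h : InnerProductSpace.rankOne ℂ (b p.1) (b q.1) =
      star (InnerProductSpace.rankOne ℂ (b q.1) (b p.1)) := by
    rw [ContinuousLinearMap.star_eq_adjoint, InnerProductSpace.adjoint_rankOne]
  rw [conjTranspose_apply, mapMatrix, of_apply, of_apply, h, hT.map_star, operatorMatrix_star,
    conjTranspose_apply]

attribute [local instance] Matrix.normedAddCommGroup Matrix.normedSpace in
/-- If `C_d ≠ C_p`, a separating functional provides a positive map that is not decomposable. -/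
lemma exists_positive_not_decomposable (h : pptCone (Fin n) ≠ separableCone (Fin n)) :
    ∃ T : (H →L[ℂ] H) →ₗ[ℂ] (H →L[ℂ] H), IsPositiveMap T ∧ ¬ IsDecomposable b T := by
  obtain ⟨X, hX, hXs⟩ : ∃ X ∈ pptCone (Fin n), X ∉ separableCone (Fin n) := by
    by_contra! hc
    exact h (Set.Subset.antisymm hc separableCone_subset_pptCone)
  obtain ⟨f, hf, hfX⟩ := exists_dual_of_notMem isClosed_separableCone separableCone_zero_mem
    (fun _ hx _ hy => separableCone_add_mem hx hy)
    (fun _ hx _ hc => separableCone_smul_mem hx hc) hXs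
  obtain ⟨C, hC, hCf⟩ := exists_isHermitian_eq_pairing f
  -- The separating functional is itself read as a Choi matrix; nonnegativity on product matrices is
  -- positivity of `T`.
  obtain ⟨T, rfl⟩ := mapMatrix_surjective b C
  refine ⟨T, fun a ha => ?_, fun hd => ?_⟩
  · rw [← operatorMatrix_posSemidef_iff b] at ha ⊢
    refine .of_dotProduct_mulVec_nonneg ?_ fun x => ?_
    · ext k l
      rw [conjTranspose_apply, operatorMatrix_map_apply, operatorMatrix_map_apply, star_sum,
        Finset.sum_comm]
      simp only [star_sum, star_mul']
      refine (Finset.sum_congr rfl fun i _ => Finset.sum_congr rfl fun j _ => ?_)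
      rw [ha.isHermitian.apply, hC.apply]
    · have hs := kronecker_mem_separableCone ha (posSemidef_vecMulVec_star_self x)
      rw [← pairing_vecMulVec, ← pairing_mapMatrix_kronecker,
        hCf _ (separableCone_subset_pptCone hs).1.isHermitian]
      have := hf _ hs
      exact_mod_cast (by positivity : 0 ≤ 2 * f _)
  · obtain ⟨P, Q, hP, hQ, hPQ⟩ := (isDecomposable_iff b).1 hd
    have h1 := hCf X hX.1.isHermitian
    -- For decomposable `T` the pairing with `X` is that of `P` with `X` plus that of `Q` with the
    -- partial transpose of `X`, both nonnegative, against `f X < 0`.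
    have h2 := add_nonneg (pairing_nonneg hP hX.1) (pairing_nonneg hQ hX.2)
    rw [← pairing_partialTransposeMatrix, ← pairing_add_left, ← hPQ, h1] at h2
    have h3 : 0 ≤ 2 * f X := by exact_mod_cast h2
    linarith

attribute [local instance] Matrix.normedAddCommGroup Matrix.normedSpace in
/-- If `C_d = C_p`, every positive map is decomposable. -/
lemma IsPositiveMap.isDecomposable (h : pptCone (Fin n) = separableCone (Fin n))
    {T : (H →L[ℂ] H) →ₗ[ℂ] (H →L[ℂ] H)} (hT : IsPositiveMap T) : IsDecomposable b T := by
  rw [isDecomposable_iff]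
  by_contra hn
  obtain ⟨f, hf, hfT⟩ := exists_dual_of_notMem isClosed_pptDualCone
    (⟨0, 0, PosSemidef.zero, PosSemidef.zero, by simp⟩ :
      (0 : Matrix (Fin n × Fin n) (Fin n × Fin n) ℂ) ∈ pptDualCone (Fin n))
    (by
      rintro _ ⟨P, Q, hP, hQ, rfl⟩ _ ⟨P', Q', hP', hQ', rfl⟩
      exact ⟨P + P', Q + Q', hP.add hP', hQ.add hQ', by rw [map_add]; abel⟩)
    (by
      rintro _ ⟨P, Q, hP, hQ, rfl⟩ c hc
      refine ⟨c • P, c • Q, posSemidef_real_smul hP hc, posSemidef_real_smul hQ hc, ?_⟩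
      rw [smul_add]
      rfl) hn
  obtain ⟨C, hC, hCf⟩ := exists_isHermitian_eq_pairing f
  -- Nonnegativity on each of the two summands of `pptDualCone` gives one of the two positivity
  -- conditions. By `h` the functional is then separable, hence nonnegative on the Choi matrix of a
  -- positive map.
  have hCp : C ∈ pptCone (Fin n) := by
    constructor
    · refine .of_dotProduct_mulVec_nonneg hC fun x => ?_
      have hx := posSemidef_vecMulVec_star_self x
      rw [← pairing_vecMulVec, hCf _ hx.isHermitian]
      have := hf _ ⟨_, 0, hx, PosSemidef.zero, by rw [map_zero, add_zero]⟩
      exact_mod_cast (by positivity : 0 ≤ 2 * f _)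
    · have hC' : (partialTransposeMatrix (Fin n) C).IsHermitian := by
        ext p q
        exact hC.apply _ _
      refine .of_dotProduct_mulVec_nonneg hC' fun x => ?_
      have hx := posSemidef_vecMulVec_star_self x
      rw [← pairing_vecMulVec, pairing_partialTransposeMatrix, hCf _ (by
        ext p q
        exact hx.isHermitian.apply _ _)]
      have := hf _ ⟨0, _, PosSemidef.zero, hx, (zero_add _).symm⟩
      exact_mod_cast (by positivity : 0 ≤ 2 * f _)
  rw [h] at hCp
  obtain ⟨m, A, B, hA, hB, rfl⟩ := hCp
  have h1 := hCf _ (hT.mapMatrix_isHermitian b)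
  have h2 : 0 ≤ pairing (∑ i, A i ⊗ₖ B i) (mapMatrix b T) := by
    have e : pairing (∑ i, A i ⊗ₖ B i) (mapMatrix b T) =
        ∑ i, pairing (mapMatrix b T) (A i ⊗ₖ B i) := by
      simp only [pairing, Matrix.sum_apply, Finset.sum_mul]
      conv_lhs => enter [2, p]; rw [Finset.sum_comm]
      rw [Finset.sum_comm]
      simp only [mul_comm]
    rw [e]
    refine Finset.sum_nonneg fun i _ => ?_
    have hAi : 0 ≤ (operatorMatrix b).symm (A i) :=
      (operatorMatrix_posSemidef_iff b).1 (by simpa using hA i)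
    have := pairing_mapMatrix_kronecker b T ((operatorMatrix b).symm (A i)) (B i)
    rw [LinearEquiv.apply_symm_apply] at this
    rw [this]
    exact pairing_nonneg ((operatorMatrix_posSemidef_iff b).2 (hT _ hAi)) (hB i)
  rw [h1] at h2
  have h3 : 0 ≤ 2 * f (mapMatrix b T) := by exact_mod_cast h2
  linarith

end Bridge
end TensorCones
end

theorem mainTheorem5 {H : Type*} [NormedAddCommGroup H] [InnerProductSpace ℂ H]
    [FiniteDimensional ℂ H] :
    (Module.finrank ℂ H = 2 → ∀ b : OrthonormalBasis (Fin 2) ℂ H,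
      TensorCones.decomposableCone b = TensorCones.projectiveCone H ∧
      ∀ h : H ⊗[ℂ] H,
        TensorCones.partialTranspose b (TensorCones.ketBra h) ∈ TensorCones.positiveCone H →
        ∃ f g : H, h = f ⊗ₜ[ℂ] g ∧
          TensorCones.ketBra h =
            InnerProductSpace.rankOne ℂ f f ⊗ₜ[ℂ] InnerProductSpace.rankOne ℂ g g) ∧
    (Module.finrank ℂ H = 3 → ∀ b : OrthonormalBasis (Fin 3) ℂ H,
      TensorCones.projectiveCone H ⊂ TensorCones.decomposableCone b ∧
      TensorCones.choiElement b ∈ TensorCones.decomposableCone b ∧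
      TensorCones.choiElement b ∉ TensorCones.projectiveCone H) ∧
    (∀ (n : ℕ) (b : OrthonormalBasis (Fin n) ℂ H),
      TensorCones.decomposableCone b ≠ TensorCones.projectiveCone H ↔
        ∃ T : (H →L[ℂ] H) →ₗ[ℂ] (H →L[ℂ] H),
          TensorCones.IsPositiveMap T ∧ ¬ TensorCones.IsDecomposable b T) := by
  open TensorCones in
  refine ⟨fun _ b => ⟨(decomposableCone_eq_iff b).2 pptCone_fin_two, fun h hh => ?_⟩,
    fun _ b => ?_, fun n b => ?_⟩
  · obtain ⟨f, g, rfl⟩ := exists_eq_tmul_of_partialTranspose_ketBra b hh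
    exact ⟨f, g, rfl, ketBra_tmul f g⟩
  · have h1 : choiElement b ∈ decomposableCone b := by
      rw [mem_decomposableCone_iff, tensorMatrix_choiElement]
      exact choiMatrix_mem_pptCone
    have h2 : choiElement b ∉ projectiveCone H := by
      rw [mem_projectiveCone_iff b, tensorMatrix_choiElement]
      exact choiMatrix_notMem_separableCone
    exact ⟨⟨projectiveCone_subset_decomposableCone b, fun h => h2 (h h1)⟩, h1, h2⟩
  · rw [Ne, decomposableCone_eq_iff]
    refine ⟨exists_positive_not_decomposable b, ?_⟩
    rintro ⟨T, hT, hd⟩ h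
    exact hd (hT.isDecomposable b h)
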